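/- **Setting.** A single item is sold to bidders $1,\dots,n$. Bidder $i$ has a private type $\theta_i=(a_i,d_i,v_i)$: arrival time $a_i$, departure time $d_i\ge a_i$, value $v_i\ge 0$. A (direct) auction maps each profile of reported types to an outcome: either no sale, or a winner $i$, an allocation time $t$ and a payment $p$. The winner's utility is $v_i-p$ if $t\in[a_i,d_i]$ and $-p$ otherwise; the other bidders have utility $0$; the revenue is $p$ (and $0$ if there is no sale). The auction is *online* if a sale made at time $t$ (winner, time, payment) depends only on the reports of bidders with arrival time at most $t$; *strategyproof* if, for all reports of the others, no bidder can increase her utility by misreporting her value, delaying her arrival, or misreporting her departure; *value-strategyproof* if no bidder can increase her utility by misreporting her value only; *individually rational* if truthful bidders never have negative utility. Its *prices never exceed the maximum value seen so far* if, whenever $i$ wins at time $t$ with payment $p$, $p$ is at most the maximum reported value of the bidders other than $i$ with arrival time at most $t$ (at most $0$ if there are none); a bidder may also receive no offer. The auction receives no prediction. Let $V=\{v_{(1)}\ge v_{(2)}\ge\dots\ge v_{(n)}\}$ be $n$ nonnegative values. They are assigned by a uniformly random permutation to the $n$ disjoint active intervals $[1,1],[2,2],\dots,[n,n]$; all reports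 are truthful. The expected revenue on $V$ is the expectation over this permutation and, for a randomized auction, over its independent internal randomness. **Theorem.** 1. There is an absolute constant $C$ such that for every $n\ge 2$ and every auction for $n$ bidders that is online, value-strategyproof (in particular, every strategyproof one), individually rational, and whose prices never exceed the maximum value seen so far (deterministic, or a probability distribution over such deterministic auctions), there are values $v_{(1)}>v_{(2)}>\dots>v_{(n)}>0$ on which its expected revenue is at most $\left(\frac14+\frac{C}{n}\right)v_{(2)}$. 2. For every $n\ge 2$ there is a deterministic, online, strategyproof, individually rational auction whose prices never exceed the maximum value seen so far and whose expected revenue is at least $\frac14 v_{(2)}$ for all values $v_{(1)}\ge\dots\ge v_{(n)}\ge 0$. Hence the approximation factor $\frac14$ is optimal within this family, up to $O(1/n)$. -/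

import Mathlib

open MeasureTheory

/-- A (true or reported) type of a bidder: arrival time, departure time, value. -/
structure BidderType where
  arrival : ℝ
  departure : ℝ
  value : ℝ

/-- A bidder departs no earlier than she arrives and has a nonnegative value. -/
def BidderType.Valid (θ : BidderType) : Prop :=
  θ.arrival ≤ θ.departure ∧ 0 ≤ θ.value

/-- One (true or reported) type for each of the `n` bidders. -/
abbrev TypeProfile (n : ℕ) := Fin n → BidderType

/-- Either the item is never sold (`none`), or it is allocated to bidder `i` at time `t` for the
payment `p` (`some (i, t, p)`). -/
abbrev Outcome (n : ℕ) := Option (Fin n × ℝ × ℝ)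

/-- The revenue of an outcome: the payment of the winner, if there is one. -/
def Outcome.revenue {n : ℕ} (o : Outcome n) : ℝ :=
  match o with
  | none => 0
  | some (_, _, p) => p

/-- The utility of bidder `i` with true type `θ`. The winner pays `p`, and the item is worth
`θ.value` to her only if she receives it while she is really active. -/
noncomputable def Outcome.utility {n : ℕ} (o : Outcome n) (i : Fin n) (θ : BidderType) : ℝ :=
  match o with
  | none => 0
  | some (j, t, p) =>
      if j = i then (if θ.arrival ≤ t ∧ t ≤ θ.departure then θ.value else 0) - p else 0

/-- A (deterministic) direct-revelation single-item auction, without predictions: the reported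
types determine the outcome. -/
abbrev Auction (n : ℕ) := TypeProfile n → Outcome n

namespace Auction

variable {n : ℕ}

/-- Online: a sale made at time `t` (winner, time and payment) depends only on the reports of the
bidders who arrive at or before time `t`. -/
def IsOnline (M : Auction n) : Prop :=
  ∀ Θ Θ' : TypeProfile n, (∀ j, (Θ j).Valid) → (∀ j, (Θ' j).Valid) →
    ∀ (i : Fin n) (t p : ℝ), M Θ = some (i, t, p) →
      (∀ j, (Θ j).arrival ≤ t ∨ (Θ' j).arrival ≤ t → Θ j = Θ' j) →
        M Θ' = some (i, t, p)

/-- Strategyproof: whatever the others report, no bidder gains by misreporting her type, where she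
may report any value, any later arrival and any departure. -/
def IsStrategyproof (M : Auction n) : Prop :=
  ∀ Θ : TypeProfile n, (∀ j, (Θ j).Valid) → ∀ (i : Fin n) (θ' : BidderType), θ'.Valid →
    (Θ i).arrival ≤ θ'.arrival →
      (M (Function.update Θ i θ')).utility i (Θ i) ≤ (M Θ).utility i (Θ i)

/-- Value-strategyproof: no bidder gains by misreporting her value only. -/
def IsValueStrategyproof (M : Auction n) : Prop :=
  ∀ Θ : TypeProfile n, (∀ j, (Θ j).Valid) → ∀ (i : Fin n) (b : ℝ), 0 ≤ b →
    (M (Function.update Θ i { Θ i with value := b })).utility i (Θ i) ≤ (M Θ).utility i (Θ i)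

theorem IsStrategyproof.isValueStrategyproof {M : Auction n} (h : M.IsStrategyproof) :
    M.IsValueStrategyproof :=
  fun Θ hΘ i _ hb => h Θ hΘ i _ ⟨(hΘ i).1, hb⟩ le_rfl

/-- Individually rational: a truthful bidder never has negative utility (she may decline a price
above her value). -/
def IsIndividuallyRational (M : Auction n) : Prop :=
  ∀ Θ : TypeProfile n, (∀ j, (Θ j).Valid) → ∀ i : Fin n, 0 ≤ (M Θ).utility i (Θ i)

/-- The maximum value reported by the bidders other than `i` who arrived at or before time `t`
(`0` if there are none). If the active intervals are disjoint and `i` is the bidder active at time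
`t`, this is the maximum of the values seen before `i`. -/
noncomputable def maxSeen (Θ : TypeProfile n) (i : Fin n) (t : ℝ) : ℝ :=
  open Classical in
  (Finset.univ.filter fun j => j ≠ i ∧ (Θ j).arrival ≤ t).fold max 0 fun j => (Θ j).value

/-- The price at which the item is sold never exceeds the maximum value seen so far. (Not offering
the item to a bidder, i.e. a posted price of `∞`, is allowed.) -/
def PricesAtMostMaxSeen (M : Auction n) : Prop :=
  ∀ Θ : TypeProfile n, (∀ j, (Θ j).Valid) → ∀ (i : Fin n) (t p : ℝ),
    M Θ = some (i, t, p) → p ≤ maxSeen Θ i t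

/-- The schedule in which the active interval of the `i`-th bidder is the single time step `i`
(time steps are `1, …, n`), and the value of the `i`-th bidder is `w i`. -/
def disjointProfile (w : Fin n → ℝ) : TypeProfile n :=
  fun i => ⟨((i : ℕ) : ℝ) + 1, ((i : ℕ) : ℝ) + 1, w i⟩

/-- The expected revenue on the values `v` when these are matched to the disjoint time steps
`1, …, n` uniformly at random. -/
noncomputable def expectedRevenue (M : Auction n) (v : Fin n → ℝ) : ℝ :=
  (∑ π : Equiv.Perm (Fin n), (M (disjointProfile (v ∘ π))).revenue) / (n.factorial : ℝ)

end Auction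

/-- Measurability of a randomized auction with random seed `ω`: for each fixed report profile, the
outcome is a random variable. -/
def MeasurableAuction {n : ℕ} {Ω : Type*} [MeasurableSpace Ω] (M : Ω → Auction n) : Prop :=
  ∀ (Θ : TypeProfile n) (i : Fin n) (S : Set (ℝ × ℝ)), MeasurableSet S →
    MeasurableSet {ω | ∃ x ∈ S, M ω Θ = some (i, x)}

/-! Upper bound. By averaging over the seed, it is enough to have one distribution of values on
which every deterministic auction does badly. The values are `n ^ s j` for an injective `s` into
`{1, …, L}`. A sequence of length `i` with maximum `m` has weight `1 / (i * m (m - 1) ⋯ (m - i +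
1))`, which is invariant under permutations. Whatever the first `i` terms are, the next one is a
record with share `1 / (i + 1)`, up to boundary errors, so magnitudes reveal nothing and only
relative ranks count. The total mass grows like a harmonic sum in `L` and absorbs all errors.

Revenue above a `1 / n` fraction of the second value arises in two ways. Either the second largest
bidder buys for a price within a factor `n` of her value; truthfulness allows one such exponent per
history, which is negligible (`SoldNearValue.unique`, `wsum_nonrecord_unique_le`). Or the largest
bidder buys after the second largest has been seen. Since prices are at most the maximum seen, a
record bidder who has an offer strictly gains by accepting and must win; hence an offer to `i` rules
out an earlier offered record (`Offered.not_record`). If `g i` is the mass of histories with an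
offer to the bidder who has `i` predecessors, then `g i + ∑ j < i, g j / (j + 1)` is at most the
total mass up to an error (`offer_constraint`). The revenue ratio from these sales is at most about
`∑ i * g i / (n (n - 1))` (`wsum_topTwoAt_le`), and the resulting linear programme
(`sum_mul_le_of_constraint`) gives `1 / 4 + O(1 / n)`.

Lower bound. Observe about half of the bidders, then charge the maximum observed. If the second
value falls in the first half and the largest in the second half, which has probability at least `1
/ 4`, the item sells for at least the second value. -/

section

open Finset

/-! ### Injective sequences and their weights -/

/-- The injective sequences of length `i` with values in `{1, …, L}`. -/
def injSeqs (L i : ℕ) : Finset (Fin i → ℕ) :=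
  (Fintype.piFinset fun _ => Icc 1 L).filter Function.Injective

/-- The largest term of a sequence. -/
def top {i : ℕ} (h : Fin i → ℕ) : ℕ := univ.sup h

/-- Weight of a sequence: the mass of all its extensions under a scale-invariant measure. -/
noncomputable def wt {i : ℕ} (h : Fin i → ℕ) : ℝ := 1 / (i * ((top h).descFactorial i : ℝ))

theorem mem_injSeqs {L i : ℕ} {h : Fin i → ℕ} :
    h ∈ injSeqs L i ↔ (∀ j, 1 ≤ h j ∧ h j ≤ L) ∧ Function.Injective h := by
  simp [injSeqs, Fintype.mem_piFinset]

theorem term_le_top {i : ℕ} (h : Fin i → ℕ) (j : Fin i) : h j ≤ top h := Finset.le_sup (mem_univ j)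

theorem exists_eq_top {i : ℕ} (hi : 1 ≤ i) (h : Fin i → ℕ) : ∃ j, h j = top h := by
  have : (univ : Finset (Fin i)).Nonempty := ⟨⟨0, hi⟩, mem_univ _⟩
  obtain ⟨j, -, hj⟩ := Finset.exists_mem_eq_sup univ this h
  exact ⟨j, hj.symm⟩

theorem top_comp {i : ℕ} (h : Fin i → ℕ) (π : Equiv.Perm (Fin i)) : top (h ∘ π) = top h := by
  apply le_antisymm
  · exact Finset.sup_le fun j _ => term_le_top h (π j)
  · refine Finset.sup_le fun j _ => ?_
    simpa using term_le_top (h ∘ π) (π.symm j)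

theorem wt_comp {i : ℕ} (h : Fin i → ℕ) (π : Equiv.Perm (Fin i)) : wt (h ∘ π) = wt h := by
  simp [wt, top_comp]

theorem wt_nonneg {i : ℕ} (h : Fin i → ℕ) : 0 ≤ wt h := by unfold wt; positivity

theorem sum_injSeqs_comp {L i : ℕ} (f : (Fin i → ℕ) → ℝ) (π : Equiv.Perm (Fin i)) :
    ∑ s ∈ injSeqs L i, f (s ∘ π) = ∑ s ∈ injSeqs L i, f s := by
  refine Finset.sum_nbij' (fun s => s ∘ π) (fun s => s ∘ π.symm) ?_ ?_ ?_ ?_ ?_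
  · intro s hs
    rw [mem_injSeqs] at hs ⊢
    exact ⟨fun j => hs.1 _, hs.2.comp π.injective⟩
  · intro s hs
    rw [mem_injSeqs] at hs ⊢
    exact ⟨fun j => hs.1 _, hs.2.comp π.symm.injective⟩
  · intro s _; ext j; simp
  · intro s _; ext j; simp
  · intro s _; rfl

theorem card_image_of_mem {L i : ℕ} {h : Fin i → ℕ} (hh : h ∈ injSeqs L i) :
    (univ.image h).card = i := by
  rw [card_image_of_injective _ (mem_injSeqs.1 hh).2]; simp

theorem length_le_top {L i : ℕ} {h : Fin i → ℕ} (hh : h ∈ injSeqs L i) : i ≤ top h := by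
  have h1 : univ.image h ⊆ Icc 1 (top h) := by
    intro x hx
    obtain ⟨j, -, rfl⟩ := mem_image.1 hx
    exact mem_Icc.2 ⟨((mem_injSeqs.1 hh).1 j).1, term_le_top h j⟩
  have := card_le_card h1
  rw [card_image_of_mem hh] at this
  simpa using this

theorem top_le {L i : ℕ} {h : Fin i → ℕ} (hh : h ∈ injSeqs L i) : top h ≤ L :=
  Finset.sup_le fun j _ => ((mem_injSeqs.1 hh).1 j).2

theorem card_injSeqs (L i : ℕ) : (injSeqs L i).card ≤ L.descFactorial i := by
  have : L.descFactorial i = Fintype.card (Fin i ↪ (Icc 1 L : Finset ℕ)) := by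
    rw [Fintype.card_embedding_eq]; simp
  rw [this, ← card_univ]
  refine Finset.card_le_card_of_surjOn (fun e j => (e j : ℕ)) ?_
  intro h hh
  have hh' := mem_injSeqs.1 (mem_coe.1 hh)
  refine ⟨⟨fun j => ⟨h j, mem_Icc.2 (hh'.1 j)⟩, fun a b hab => hh'.2 ?_⟩, by simp, rfl⟩
  simpa using hab

/-! ### One-term extensions: records and non-records -/

/-- Appending a term to a sequence. -/
abbrev app {i : ℕ} (h : Fin i → ℕ) (x : ℕ) : Fin (i + 1) → ℕ := Fin.snoc (α := fun _ => ℕ) h x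

theorem top_app {i : ℕ} (h : Fin i → ℕ) (x : ℕ) : top (app h x) = max (top h) x := by
  apply le_antisymm
  · refine Finset.sup_le fun j _ => ?_
    refine Fin.lastCases ?_ (fun j => ?_) j
    · simp
    · simp [term_le_top h j]
  · refine max_le (Finset.sup_le fun j _ => ?_) ?_
    · simpa using term_le_top (app h x) j.castSucc
    · simpa using term_le_top (app h x) (Fin.last i)

theorem sum_injSeqs_succ {L i : ℕ} (f : (Fin (i + 1) → ℕ) → ℝ) :
    ∑ s ∈ injSeqs L (i + 1), f s =
      ∑ h ∈ injSeqs L i, ∑ x ∈ (Icc 1 L) \ univ.image h, f (app h x) := by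
  rw [Finset.sum_sigma']
  refine Finset.sum_bij' (fun s _ => ⟨Fin.init (α := fun _ => ℕ) s, s (Fin.last i)⟩)
    (fun p _ => app p.1 p.2) ?_ ?_ ?_ ?_ ?_
  · intro s hs
    rw [mem_injSeqs] at hs
    simp only [mem_sigma, mem_injSeqs, mem_sdiff, mem_Icc, mem_image, mem_univ, true_and, not_exists]
    refine ⟨⟨fun j => hs.1 _, fun a b hab => ?_⟩, hs.1 _, fun j hj => ?_⟩
    · exact Fin.castSucc_injective _ (hs.2 hab)
    · exact (Fin.castSucc_lt_last j).ne (hs.2 hj)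
  · rintro ⟨h, x⟩ hp
    simp only [mem_sigma, mem_injSeqs, mem_sdiff, mem_Icc, mem_image, mem_univ, true_and,
      not_exists] at hp
    rw [mem_injSeqs]
    refine ⟨fun j => ?_, ?_⟩
    · refine Fin.lastCases ?_ (fun j => ?_) j
      · simpa using hp.2.1
      · simpa using hp.1.1 j
    · exact Fin.snoc_injective_iff.2 ⟨hp.1.2, by simpa using hp.2.2⟩
  · intro s _; simp
  · rintro ⟨h, x⟩ _; simp
  · intro s _; simp

theorem image_subset_Icc_top {L i : ℕ} {h : Fin i → ℕ} (hh : h ∈ injSeqs L i) :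
    univ.image h ⊆ Icc 1 (top h) := by
  intro x hx
  obtain ⟨j, -, rfl⟩ := mem_image.1 hx
  exact mem_Icc.2 ⟨((mem_injSeqs.1 hh).1 j).1, term_le_top h j⟩

theorem descFactorial_top_pos {L i : ℕ} {h : Fin i → ℕ} (hh : h ∈ injSeqs L i) :
    (0 : ℝ) < (top h).descFactorial i := by
  exact_mod_cast Nat.descFactorial_pos.2 (length_le_top hh)

theorem wt_app_nonrecord {i : ℕ} {h : Fin i → ℕ} {x : ℕ} (hx : x ≤ top h) :
    wt (app h x) = 1 / (((i : ℝ) + 1) * (((top h - i : ℕ) : ℝ) * (top h).descFactorial i)) := by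
  simp [wt, top_app, max_eq_left hx, Nat.descFactorial_succ]

/-- There are `top h - i` unused values below the maximum, all giving the same weight. If `top h =
i` there are none, and the share `i / (i + 1)` is lost. -/
theorem sum_app_nonrecord {L i : ℕ} (hi : 1 ≤ i) {h : Fin i → ℕ} (hh : h ∈ injSeqs L i) :
    ∑ x ∈ Icc 1 (top h) \ univ.image h, wt (app h x) =
      if top h = i then 0 else (i : ℝ) / (i + 1) * wt h := by
  rw [sum_congr rfl fun x hx => wt_app_nonrecord (mem_Icc.1 (mem_sdiff.1 hx).1).2, sum_const,
    card_sdiff_of_subset (image_subset_Icc_top hh), card_image_of_mem hh, Nat.card_Icc]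
  have hle := length_le_top hh
  have hpos := descFactorial_top_pos hh
  have hi' : (0 : ℝ) < i := by exact_mod_cast hi
  split_ifs with he
  · simp [he]
  · have : ((top h - i : ℕ) : ℝ) ≠ 0 := by
      have : 0 < top h - i := by omega
      exact_mod_cast this.ne'
    simp only [wt, nsmul_eq_mul, Nat.add_sub_cancel]
    field_simp

/-- Telescoping: `i / (x)_{i+1} = 1 / (x-1)_i - 1 / (x)_i` for falling factorials. -/
theorem sum_inv_descFactorial {i m L : ℕ} (hi : 1 ≤ i) (hm : i ≤ m) (hL : m ≤ L) :
    ∑ x ∈ Icc (m + 1) L, 1 / (((i : ℝ) + 1) * (x.descFactorial (i + 1) : ℝ)) =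
      1 / ((i : ℝ) * (i + 1)) * (1 / (m.descFactorial i : ℝ) - 1 / (L.descFactorial i : ℝ)) := by
  induction L, hL using Nat.le_induction with
  | base => simp
  | succ L hL ih =>
    rw [sum_Icc_succ_top (by omega), ih]
    have h1 : (0 : ℝ) < L.descFactorial i := by
      exact_mod_cast Nat.descFactorial_pos.2 (hm.trans hL)
    have h2 : (0 : ℝ) < (L + 1).descFactorial i := by
      exact_mod_cast Nat.descFactorial_pos.2 (by omega)
    have h3 : ((L + 1 - i : ℕ) : ℝ) = L + 1 - i := by
      rw [Nat.cast_sub (by omega)]; push_cast; ring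
    have h4 : (0 : ℝ) < (L : ℝ) + 1 - i := by
      rw [← h3]; exact_mod_cast (by omega : 0 < L + 1 - i)
    have h5 : ((L : ℝ) + 1 - i) * (L + 1).descFactorial i = (L + 1) * L.descFactorial i := by
      have := (Nat.descFactorial_succ (L + 1) i).symm.trans (Nat.succ_descFactorial_succ L i)
      rw [← h3]; exact_mod_cast this
    have h6 : ((L + 1).descFactorial (i + 1) : ℝ) = (L + 1) * L.descFactorial i := by
      exact_mod_cast Nat.succ_descFactorial_succ L i
    have h7 : (0 : ℝ) < m.descFactorial i := by
      exact_mod_cast Nat.descFactorial_pos.2 hm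
    have hi' : (0 : ℝ) < i := by exact_mod_cast hi
    have h8 : 1 / ((L + 1).descFactorial i : ℝ) =
        ((L : ℝ) + 1 - i) / ((L + 1) * L.descFactorial i) := by
      rw [← h5]; field_simp
    rw [h6, h8]
    field_simp
    ring

/-- The share `1 / (i + 1)` does not depend on `h`; the subtracted term is the tail cut off at `L`.
-/
theorem sum_app_record {L i : ℕ} (hi : 1 ≤ i) {h : Fin i → ℕ} (hh : h ∈ injSeqs L i) :
    ∑ x ∈ Icc (top h + 1) L, wt (app h x) =
      1 / ((i : ℝ) + 1) * wt h - 1 / ((i : ℝ) * (i + 1)) * (1 / (L.descFactorial i : ℝ)) := by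
  have h1 : ∀ x ∈ Icc (top h + 1) L,
      wt (app h x) = 1 / (((i : ℝ) + 1) * (x.descFactorial (i + 1) : ℝ)) := by
    intro x hx
    have : max (top h) x = x := max_eq_right (by have := (mem_Icc.1 hx).1; omega)
    simp [wt, top_app, this]
  rw [sum_congr rfl h1, sum_inv_descFactorial hi (length_le_top hh) (top_le hh), mul_sub]
  congr 1
  have hpos := descFactorial_top_pos hh
  have hi' : (0 : ℝ) < i := by exact_mod_cast hi
  simp only [wt]
  field_simp

theorem sum_app_split {L i : ℕ} {h : Fin i → ℕ} (hh : h ∈ injSeqs L i) (f : ℕ → ℝ) :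
    ∑ x ∈ Icc 1 L \ univ.image h, f x =
      ∑ x ∈ Icc 1 (top h) \ univ.image h, f x + ∑ x ∈ Icc (top h + 1) L, f x := by
  rw [← sum_union]
  · congr 1
    ext x
    have h1 := top_le hh
    have h2 : x ∈ univ.image h → x ≤ top h := fun hx =>
      (mem_Icc.1 (image_subset_Icc_top hh hx)).2
    simp only [mem_union, mem_sdiff, mem_Icc]
    constructor
    · rintro ⟨⟨a, b⟩, c⟩
      by_cases hx : x ≤ top h
      · exact Or.inl ⟨⟨a, hx⟩, c⟩
      · exact Or.inr ⟨by omega, b⟩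
    · rintro (⟨⟨a, b⟩, c⟩ | ⟨a, b⟩)
      · exact ⟨⟨a, b.trans h1⟩, c⟩
      · exact ⟨⟨by omega, b⟩, fun hx => by have := h2 hx; omega⟩
  · rw [disjoint_left]
    intro x hx hx'
    have h3 := (mem_Icc.1 (mem_sdiff.1 hx).1).2
    have h4 := (mem_Icc.1 hx').1
    omega

/-! ### Weighted totals, marginals and rank events -/

/-- Weighted total of `Φ` over the injective sequences. -/
noncomputable def wsum (L : ℕ) {i : ℕ} (Φ : (Fin i → ℕ) → ℝ) : ℝ := ∑ s ∈ injSeqs L i, wt s * Φ s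

theorem wsum_mono {L i : ℕ} {Φ Ψ : (Fin i → ℕ) → ℝ} (h : ∀ s ∈ injSeqs L i, Φ s ≤ Ψ s) :
    wsum L Φ ≤ wsum L Ψ :=
  sum_le_sum fun s hs => mul_le_mul_of_nonneg_left (h s hs) (wt_nonneg s)

/-- The terms before the last one. -/
abbrev ini {i : ℕ} (s : Fin (i + 1) → ℕ) : Fin i → ℕ := Fin.init (α := fun _ => ℕ) s

open Classical in
theorem wsum_record {L i : ℕ} (hi : 1 ≤ i) (Φ : (Fin i → ℕ) → ℝ) :
    wsum L (fun s : Fin (i + 1) → ℕ => if top (ini s) < s (Fin.last i) then Φ (ini s) else 0) =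
      ∑ h ∈ injSeqs L i, Φ h * (1 / ((i : ℝ) + 1) * wt h -
        1 / ((i : ℝ) * (i + 1)) * (1 / (L.descFactorial i : ℝ))) := by
  unfold wsum
  rw [sum_injSeqs_succ]
  refine sum_congr rfl fun h hh => ?_
  rw [sum_app_split hh, ← sum_app_record hi hh, mul_sum]
  have h1 : ∀ x ∈ Icc 1 (top h) \ univ.image h, ¬ top h < x := by
    intro x hx
    have := (mem_Icc.1 (mem_sdiff.1 hx).1).2
    omega
  have h2 : ∀ x ∈ Icc (top h + 1) L, top h < x := fun x hx => (mem_Icc.1 hx).1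
  simp only [Fin.init_snoc, Fin.snoc_last]
  rw [sum_eq_zero (fun x hx => by simp [h1 x hx]), zero_add]
  exact sum_congr rfl fun x hx => by rw [if_pos (h2 x hx), mul_comm]

open Classical in
theorem wsum_nonrecord {L i : ℕ} (hi : 1 ≤ i) (Φ : (Fin i → ℕ) → ℝ) :
    wsum L (fun s : Fin (i + 1) → ℕ => if top (ini s) < s (Fin.last i) then 0 else Φ (ini s)) =
      ∑ h ∈ injSeqs L i, Φ h * (if top h = i then 0 else (i : ℝ) / (i + 1) * wt h) := by
  unfold wsum
  rw [sum_injSeqs_succ]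
  refine sum_congr rfl fun h hh => ?_
  rw [sum_app_split hh, ← sum_app_nonrecord hi hh, mul_sum]
  have h1 : ∀ x ∈ Icc 1 (top h) \ univ.image h, ¬ top h < x := by
    intro x hx
    have := (mem_Icc.1 (mem_sdiff.1 hx).1).2
    omega
  have h2 : ∀ x ∈ Icc (top h + 1) L, top h < x := fun x hx => (mem_Icc.1 hx).1
  simp only [Fin.init_snoc, Fin.snoc_last]
  rw [add_comm, sum_eq_zero (fun x hx => by simp [h2 x hx]), zero_add]
  exact sum_congr rfl fun x hx => by rw [if_neg (h1 x hx), mul_comm]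

open Classical in
theorem wsum_record_le {L i : ℕ} (hi : 1 ≤ i) {Φ : (Fin i → ℕ) → ℝ} (h0 : ∀ h, 0 ≤ Φ h) :
    wsum L (fun s : Fin (i + 1) → ℕ => if top (ini s) < s (Fin.last i) then Φ (ini s) else 0) ≤
      1 / ((i : ℝ) + 1) * wsum L Φ := by
  rw [wsum_record hi, wsum, mul_sum]
  refine sum_le_sum fun h _ => ?_
  have h1 : 0 ≤ 1 / ((i : ℝ) * (i + 1)) * (1 / (L.descFactorial i : ℝ)) := by positivity
  have := mul_le_mul_of_nonneg_left h1 (h0 h)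
  linarith

-- The truncation loss is the same for every history, and there are at most `L.descFactorial i`
-- histories, so the total loss does not grow with `L`.
open Classical in
theorem le_wsum_record {L i : ℕ} (hi : 1 ≤ i) {Φ : (Fin i → ℕ) → ℝ} (h1 : ∀ h, Φ h ≤ 1) :
    1 / ((i : ℝ) + 1) * wsum L Φ - 1 / ((i : ℝ) * (i + 1)) ≤
      wsum L (fun s : Fin (i + 1) → ℕ =>
        if top (ini s) < s (Fin.last i) then Φ (ini s) else 0) := by
  rw [wsum_record hi, wsum, mul_sum]
  simp only [mul_sub, sum_sub_distrib]
  have e1 : ∑ h ∈ injSeqs L i, 1 / ((i : ℝ) + 1) * (wt h * Φ h) =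
      ∑ h ∈ injSeqs L i, Φ h * (1 / ((i : ℝ) + 1) * wt h) :=
    sum_congr rfl fun h _ => by ring
  rw [e1, ← sum_mul]
  refine sub_le_sub_left ?_ _
  have h2 : ∑ h ∈ injSeqs L i, Φ h ≤ L.descFactorial i := by
    calc ∑ h ∈ injSeqs L i, Φ h ≤ ∑ h ∈ injSeqs L i, (1 : ℝ) := sum_le_sum fun h _ => h1 h
      _ = (injSeqs L i).card := by simp
      _ ≤ _ := by exact_mod_cast card_injSeqs L i
  have h3 : (0 : ℝ) ≤ 1 / ((i : ℝ) * (i + 1)) := by positivity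
  calc _ ≤ (L.descFactorial i : ℝ) * (1 / ((i : ℝ) * (i + 1)) * (1 / (L.descFactorial i : ℝ))) :=
        mul_le_mul_of_nonneg_right h2 (by positivity)
    _ = 1 / ((i : ℝ) * (i + 1)) * ((L.descFactorial i : ℝ) / L.descFactorial i) := by ring
    _ ≤ 1 / ((i : ℝ) * (i + 1)) * 1 := mul_le_mul_of_nonneg_left (div_self_le_one _) h3
    _ = _ := mul_one _

open Classical in
theorem wsum_nonrecord_le {L i : ℕ} (hi : 1 ≤ i) {Φ : (Fin i → ℕ) → ℝ} (h0 : ∀ h, 0 ≤ Φ h) :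
    wsum L (fun s : Fin (i + 1) → ℕ => if top (ini s) < s (Fin.last i) then 0 else Φ (ini s)) ≤
      (i : ℝ) / (i + 1) * wsum L Φ := by
  rw [wsum_nonrecord hi, wsum, mul_sum]
  refine sum_le_sum fun h _ => ?_
  have h1 : (0 : ℝ) ≤ i / (i + 1) * wt h := mul_nonneg (by positivity) (wt_nonneg h)
  have h2 : (if top h = i then 0 else (i : ℝ) / (i + 1) * wt h) ≤ i / (i + 1) * wt h := by
    split_ifs
    · exact h1
    · exact le_rfl
  calc _ ≤ Φ h * (i / (i + 1) * wt h) := mul_le_mul_of_nonneg_left h2 (h0 h)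
    _ = _ := by ring

-- Only the histories with `top h = i` lose mass. These are arrangements of `1, …, i`, at most `i!`
-- of them, each losing at most `1 / ((i + 1) * i!)`.
open Classical in
theorem le_wsum_nonrecord {L i : ℕ} (hi : 1 ≤ i) {Φ : (Fin i → ℕ) → ℝ} (h1 : ∀ h, Φ h ≤ 1) :
    (i : ℝ) / (i + 1) * wsum L Φ - 1 / ((i : ℝ) + 1) ≤
      wsum L (fun s : Fin (i + 1) → ℕ =>
        if top (ini s) < s (Fin.last i) then 0 else Φ (ini s)) := by
  have hi' : (0 : ℝ) < i := by exact_mod_cast hi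
  have key : ∑ h ∈ injSeqs L i, (if top h = i then 1 / (((i : ℝ) + 1) * (i.factorial : ℝ)) else 0)
      ≤ 1 / ((i : ℝ) + 1) := by
    rw [← sum_filter, sum_const, nsmul_eq_mul]
    have h2 : ((injSeqs L i).filter fun h => top h = i).card ≤ i.factorial := by
      have h3 : ((injSeqs L i).filter fun h => top h = i) ⊆ injSeqs i i := by
        intro h hh
        obtain ⟨ha, hb⟩ := mem_filter.1 hh
        have hc := mem_injSeqs.1 ha
        exact mem_injSeqs.2 ⟨fun j => ⟨(hc.1 j).1, hb ▸ term_le_top h j⟩, hc.2⟩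
      exact (card_le_card h3).trans ((card_injSeqs i i).trans (Nat.descFactorial_self i).le)
    have h4 : (0 : ℝ) < i.factorial := by exact_mod_cast i.factorial_pos
    calc _ ≤ (i.factorial : ℝ) * (1 / (((i : ℝ) + 1) * (i.factorial : ℝ))) :=
          mul_le_mul_of_nonneg_right (by exact_mod_cast h2) (by positivity)
      _ = _ := by field_simp
  refine (sub_le_sub_left key _).trans ?_
  rw [wsum_nonrecord hi, wsum, mul_sum, ← sum_sub_distrib]
  refine sum_le_sum fun h hh => ?_
  split_ifs with he
  · have h5 : (0 : ℝ) < i.factorial := by exact_mod_cast i.factorial_pos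
    have h6 : wt h = 1 / ((i : ℝ) * i.factorial) := by simp [wt, he, Nat.descFactorial_self]
    have h7 : (i : ℝ) / (i + 1) * (wt h * 1) = 1 / (((i : ℝ) + 1) * (i.factorial : ℝ)) := by
      rw [h6]; field_simp
    have h8 : (i : ℝ) / (i + 1) * (wt h * Φ h) ≤ (i : ℝ) / (i + 1) * (wt h * 1) :=
      mul_le_mul_of_nonneg_left (mul_le_mul_of_nonneg_left (h1 h) (wt_nonneg h)) (by positivity)
    linarith
  · linarith [mul_comm (Φ h) (i / (i + 1) * wt h)]

theorem wsum_add {L i : ℕ} (Φ Ψ : (Fin i → ℕ) → ℝ) :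
    wsum L (fun s => Φ s + Ψ s) = wsum L Φ + wsum L Ψ := by
  simp [wsum, mul_add, sum_add_distrib]

open Classical in
theorem wsum_ini_eq {L i : ℕ} (Φ : (Fin i → ℕ) → ℝ) :
    wsum L (fun s : Fin (i + 1) → ℕ => Φ (ini s)) =
      wsum L (fun s : Fin (i + 1) → ℕ =>
        if top (ini s) < s (Fin.last i) then Φ (ini s) else 0) +
      wsum L (fun s : Fin (i + 1) → ℕ =>
        if top (ini s) < s (Fin.last i) then 0 else Φ (ini s)) := by
  rw [← wsum_add]
  congr 1
  ext s
  split_ifs <;> simp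

theorem wsum_ini_le {L i : ℕ} (hi : 1 ≤ i) {Φ : (Fin i → ℕ) → ℝ} (h0 : ∀ h, 0 ≤ Φ h) :
    wsum L (fun s : Fin (i + 1) → ℕ => Φ (ini s)) ≤ wsum L Φ := by
  rw [wsum_ini_eq]
  have h1 := wsum_record_le (L := L) hi h0
  have h2 := wsum_nonrecord_le (L := L) hi h0
  have h3 : 1 / ((i : ℝ) + 1) * wsum L Φ + i / (i + 1) * wsum L Φ = wsum L Φ := by field_simp; ring
  linarith

theorem le_wsum_ini {L i : ℕ} (hi : 1 ≤ i) {Φ : (Fin i → ℕ) → ℝ} (h1 : ∀ h, Φ h ≤ 1) :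
    wsum L Φ - 1 ≤ wsum L (fun s : Fin (i + 1) → ℕ => Φ (ini s)) := by
  rw [wsum_ini_eq]
  have h2 := le_wsum_record (L := L) hi h1
  have h4 := le_wsum_nonrecord (L := L) hi h1
  have hi' : (1 : ℝ) ≤ i := by exact_mod_cast hi
  have h3 : 1 / ((i : ℝ) + 1) * wsum L Φ + i / (i + 1) * wsum L Φ = wsum L Φ := by field_simp; ring
  have h5 : 1 / ((i : ℝ) * (i + 1)) + 1 / ((i : ℝ) + 1) = 1 / i := by field_simp; ring
  have h6 : 1 / (i : ℝ) ≤ 1 := by rw [div_le_one (by linarith)]; exact hi'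
  linarith

/-- The first `i` terms of a sequence. -/
abbrev pre {i n : ℕ} (hi : i ≤ n) (s : Fin n → ℕ) : Fin i → ℕ := fun j => s (Fin.castLE hi j)

theorem wsum_pre_le {L i n : ℕ} (hi : 1 ≤ i) (hn : i ≤ n) {Φ : (Fin i → ℕ) → ℝ}
    (h0 : ∀ h, 0 ≤ Φ h) : wsum L (fun s : Fin n → ℕ => Φ (pre hn s)) ≤ wsum L Φ := by
  induction n, hn using Nat.le_induction with
  | base => exact le_rfl
  | succ n hn ih =>
    exact (wsum_ini_le (hi.trans hn) (Φ := fun s : Fin n → ℕ => Φ (pre hn s))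
      fun h => h0 _).trans ih

theorem le_wsum_pre {L i n : ℕ} (hi : 1 ≤ i) (hn : i ≤ n) {Φ : (Fin i → ℕ) → ℝ}
    (h1 : ∀ h, Φ h ≤ 1) : wsum L Φ - (n - i : ℕ) ≤ wsum L (fun s : Fin n → ℕ => Φ (pre hn s)) := by
  induction n, hn using Nat.le_induction with
  | base =>
    simp only [Nat.sub_self, Nat.cast_zero, sub_zero]
    exact le_rfl
  | succ n hn ih =>
    have := le_wsum_ini (L := L) (hi.trans hn) (Φ := fun s : Fin n → ℕ => Φ (pre hn s))
      fun h => h1 _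
    have h2 : ((n + 1 - i : ℕ) : ℝ) = (n - i : ℕ) + 1 := by
      rw [Nat.succ_sub hn]; push_cast; ring
    rw [h2]
    change _ ≤ wsum L (fun s : Fin (n + 1) → ℕ => Φ (pre hn (ini s)))
    linarith

/-- In length one the mass is a harmonic sum, hence unbounded in `L`; extending to length `n` costs
at most `n - 1`. -/
theorem exists_le_wsum_one {n : ℕ} (hn : 1 ≤ n) (R : ℝ) :
    ∃ L, R ≤ wsum L (fun _ : Fin n → ℕ => 1) := by
  have h1 : Filter.Tendsto (fun L : ℕ => ∑ x ∈ range L, 1 / ((x : ℝ) + 1)) Filter.atTop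
      Filter.atTop := Real.tendsto_sum_range_one_div_nat_succ_atTop
  obtain ⟨L, hL⟩ := (h1.eventually_ge_atTop (R + n)).exists
  refine ⟨L, ?_⟩
  have h2 := le_wsum_pre (L := L) le_rfl hn (Φ := fun _ => 1) fun _ => le_rfl
  have h3 : wsum L (fun _ : Fin 1 → ℕ => 1) = ∑ x ∈ range L, 1 / ((x : ℝ) + 1) := by
    have e : injSeqs L 0 = {fun j => j.elim0} := by
      ext h
      rw [mem_injSeqs, mem_singleton]
      refine ⟨fun _ => Subsingleton.elim _ _, fun _ => ⟨fun j => j.elim0, fun j => j.elim0⟩⟩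
    unfold wsum
    rw [sum_injSeqs_succ, e, sum_singleton]
    rw [show (Icc 1 L \ univ.image fun j : Fin 0 => (j.elim0 : ℕ)) = Icc 1 L by simp]
    have h5 := sum_Ico_add' (fun x : ℕ => 1 / (x : ℝ)) 0 L 1
    simp only [Nat.cast_add, Nat.cast_one, zero_add] at h5
    rw [range_eq_Ico, h5]
    refine sum_congr (by ext; simp) fun x _ => ?_
    have h6 : top (app (fun j : Fin 0 => (j.elim0 : ℕ)) x) = x := by rw [top_app]; simp [top]
    simp [wt, h6]
  have h4 : ((n - 1 : ℕ) : ℝ) ≤ n := by exact_mod_cast Nat.sub_le n 1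
  rw [h3] at h2
  linarith

theorem top_pre_le {i n : ℕ} (hi : i ≤ n) (s : Fin n → ℕ) : top (pre hi s) ≤ top s :=
  Finset.sup_le fun _ _ => term_le_top s _

theorem top_ini_le {n : ℕ} (s : Fin (n + 1) → ℕ) : top (ini s) ≤ top s :=
  Finset.sup_le fun j _ => term_le_top s j.castSucc

-- None of the later terms is a record; the shares `j / (j + 1)` for `i ≤ j < n` multiply to `i /
-- n`.
open Classical in
theorem wsum_top_pre_le {L i n : ℕ} (hi : 1 ≤ i) (hn : i ≤ n) {Φ : (Fin i → ℕ) → ℝ}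
    (h0 : ∀ h, 0 ≤ Φ h) :
    wsum L (fun s : Fin n → ℕ => if top s = top (pre hn s) then Φ (pre hn s) else 0) ≤
      (i : ℝ) / n * wsum L Φ := by
  have hi' : (0 : ℝ) < i := by exact_mod_cast hi
  induction n, hn using Nat.le_induction with
  | base =>
    rw [div_self hi'.ne', one_mul]
    refine wsum_mono fun s _ => ?_
    split_ifs
    · exact le_rfl
    · exact h0 _
  | succ n hn ih =>
    have hn' : (0 : ℝ) < n := by exact_mod_cast hi.trans hn
    have h1 := wsum_nonrecord_le (L := L) (hi.trans hn)
      (Φ := fun s : Fin n → ℕ => if top s = top (pre hn s) then Φ (pre hn s) else 0)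
      fun h => by split_ifs; exacts [h0 _, le_rfl]
    have h2 : (n : ℝ) / (n + 1) * ((i : ℝ) / n * wsum L Φ) = i / (n + 1 : ℕ) * wsum L Φ := by
      push_cast; field_simp
    rw [← h2]
    refine (wsum_mono fun s _ => ?_).trans
      (h1.trans (mul_le_mul_of_nonneg_left ih (by positivity)))
    have e : pre (hn.trans n.le_succ) s = pre hn (ini s) := rfl
    have h3 := top_pre_le hn (ini s)
    have h4 := top_ini_le s
    have h5 := term_le_top s (Fin.last n)
    rw [e]
    split_ifs with ha hb hc hd he
    · omega
    · exact le_rfl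
    · omega
    · exact le_rfl
    · exact h0 _
    · exact le_rfl

/-- The `i`-th term (counted from `0`) is the largest and the largest term before it is the second
largest one. -/
def TopTwoAt {n : ℕ} (i : Fin n) (s : Fin n → ℕ) : Prop :=
  (∀ j < i, s j < s i) ∧ ∀ j, i < j → s j ≤ top (pre i.2.le s)

-- Exchanging position `i` with the last one preserves weights. The event then forces the last term
-- to be a record while the maximum of the other terms lies among the first `i`, which gives the
-- product of the two shares.
open Classical in
theorem wsum_topTwoAt_le {L n : ℕ} (i : Fin n) (hi : 1 ≤ (i : ℕ)) {Φ : (Fin i → ℕ) → ℝ}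
    (h0 : ∀ h, 0 ≤ Φ h) :
    wsum L (fun s : Fin n → ℕ => if TopTwoAt i s then Φ (pre i.2.le s) else 0) ≤
      (i : ℝ) / (n * (n - 1)) * wsum L Φ := by
  obtain _ | n := n
  · exact i.elim0
  have hin : (i : ℕ) ≤ n := Nat.lt_succ_iff.1 i.2
  have hn' : (0 : ℝ) < n := by exact_mod_cast hi.trans hin
  have h1 := wsum_top_pre_le (L := L) hi hin h0
  have h2 := wsum_record_le (L := L) (hi.trans hin)
    (Φ := fun s : Fin n → ℕ => if top s = top (pre hin s) then Φ (pre hin s) else 0)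
      fun h => by split_ifs; exacts [h0 _, le_rfl]
  have h3 : 1 / ((n : ℝ) + 1) * ((i : ℝ) / n * wsum L Φ) =
      (i : ℝ) / ((n + 1 : ℕ) * ((n + 1 : ℕ) - 1)) * wsum L Φ := by
    push_cast; rw [add_sub_cancel_right]; field_simp
  rw [← h3]
  refine le_trans ?_ (h2.trans (mul_le_mul_of_nonneg_left h1 (by positivity)))
  unfold wsum
  rw [← sum_injSeqs_comp _ (Equiv.swap i (Fin.last n))]
  refine sum_le_sum fun s _ => ?_
  rw [wt_comp]
  refine mul_le_mul_of_nonneg_left ?_ (wt_nonneg s)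
  set t := s ∘ Equiv.swap i (Fin.last n) with ht
  have e1 : ∀ (j : Fin (n + 1)), j ≠ i → j ≠ Fin.last n → t j = s j := fun j h h' => by
    simp [ht, Equiv.swap_apply_of_ne_of_ne h h']
  have e2 : t i = s (Fin.last n) := by simp [ht]
  have e3 : t (Fin.last n) = s i := by simp [ht]
  have hpre : pre i.2.le t = pre hin (ini s) := by
    ext j
    have hj := j.2
    refine e1 _ (Fin.ne_of_val_ne ?_) (Fin.ne_of_val_ne ?_)
    · simp; omega
    · simp; omega
  by_cases ha : TopTwoAt i t
  · have hc : top (ini s) = top (pre hin (ini s)) := by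
      refine le_antisymm (Finset.sup_le fun j _ => ?_) (top_pre_le _ _)
      rw [← hpre]
      by_cases hji : (j : ℕ) < i
      · rw [hpre]
        exact term_le_top (pre hin (ini s)) ⟨j, hji⟩
      · by_cases hji' : (j : ℕ) = i
        · have : i < Fin.last n := by rw [Fin.lt_def]; simp; omega
          have h5 := ha.2 _ this
          rw [e3] at h5
          have : (j.castSucc) = i := Fin.ext hji'
          change s j.castSucc ≤ _
          rw [this]; exact h5
        · have h5 := ha.2 j.castSucc (by rw [Fin.lt_def]; simp; omega)
          rw [e1 _ (Fin.ne_of_val_ne (by simpa using hji')) (Fin.castSucc_lt_last j).ne] at h5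
          exact h5
    have hb : top (ini s) < s (Fin.last n) := by
      rw [hc]
      obtain ⟨j, hj⟩ := exists_eq_top hi (pre hin (ini s))
      rw [← hj, ← hpre, ← e2]
      exact ha.1 _ (by rw [Fin.lt_def]; exact j.2)
    simp only [if_pos ha, if_pos hb, if_pos hc, hpre]
    exact le_rfl
  · simp only [if_neg ha]
    split_ifs
    · exact h0 _
    · exact le_rfl
    · exact le_rfl

/-- A non-record extension shares its parent's weight with `top h - i` equally heavy ones, so it is
light unless the maximum is small. -/
theorem wt_app_le {L i K : ℕ} (hi : 1 ≤ i) (hK : 1 ≤ K) {h : Fin i → ℕ} (hh : h ∈ injSeqs L i)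
    {x : ℕ} (hx : x ≤ top h) :
    wt (app h x) ≤ wt h / K + if top h < K + i then 1 else 0 := by
  have h1 := descFactorial_top_pos hh
  have hi' : (1 : ℝ) ≤ i := by exact_mod_cast hi
  have hK' : (1 : ℝ) ≤ K := by exact_mod_cast hK
  split_ifs with hm
  · have h0 : 0 ≤ wt h / K := div_nonneg (wt_nonneg h) (by positivity)
    have h2 : wt (app h x) ≤ 1 := by
      rw [wt_app_nonrecord hx]
      rcases Nat.eq_zero_or_pos (top h - i) with h3 | h3
      · simp [h3]
      · have h4 : (1 : ℝ) ≤ ((top h - i : ℕ) : ℝ) := by exact_mod_cast h3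
        have h5 : (1 : ℝ) ≤ (top h).descFactorial i := by
          exact_mod_cast Nat.descFactorial_pos.2 (length_le_top hh)
        rw [div_le_one (by positivity)]
        have h6 := one_le_mul_of_one_le_of_one_le h4 h5
        nlinarith
    linarith
  · rw [add_zero, wt_app_nonrecord hx]
    have h4 : (K : ℝ) ≤ ((top h - i : ℕ) : ℝ) := by exact_mod_cast (by omega)
    unfold wt
    rw [div_div]
    refine one_div_le_one_div_of_le (by positivity) ?_
    calc (i : ℝ) * (top h).descFactorial i * K ≤
          ((i : ℝ) + 1) * (top h).descFactorial i * ((top h - i : ℕ) : ℝ) := by gcongr; linarith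
      _ = _ := by ring

-- If each history allows at most one critical non-record value, the event is negligible: a fraction
-- `1 / K` of the mass, plus at most `1` for each of the at most `(K + i) ^ i` histories with small
-- maximum.
open Classical in
theorem wsum_nonrecord_unique_le {L i K : ℕ} (hi : 1 ≤ i) (hK : 1 ≤ K)
    (P : (Fin (i + 1) → ℕ) → Prop) (hP : ∀ h x y, P (app h x) → P (app h y) → x = y) :
    wsum L (fun s : Fin (i + 1) → ℕ => if s (Fin.last i) ≤ top (ini s) ∧ P s then 1 else 0) ≤
      wsum L (fun _ : Fin i → ℕ => 1) / K + (K + i : ℕ) ^ i := by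
  have key : ∀ h ∈ injSeqs L i, ∑ x ∈ Icc 1 L \ univ.image h,
      wt (app h x) * (if x ≤ top h ∧ P (app h x) then 1 else 0) ≤
        wt h / K + if top h < K + i then 1 else 0 := by
    intro h hh
    have h0 : 0 ≤ wt h / K + if top h < K + i then 1 else 0 :=
      add_nonneg (div_nonneg (wt_nonneg h) (by positivity)) (by split_ifs <;> norm_num)
    by_cases hex : ∃ x, x ≤ top h ∧ P (app h x)
    · obtain ⟨x, hx, hPx⟩ := hex
      calc _ ≤ ∑ y ∈ {x}, wt (app h y) := ?_
        _ ≤ _ := by rw [sum_singleton]; exact wt_app_le hi hK hh hx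
      simp only [mul_ite, mul_one, mul_zero]
      rw [← sum_filter]
      refine sum_le_sum_of_subset_of_nonneg ?_ fun y _ _ => wt_nonneg _
      intro y hy
      exact mem_singleton.2 (hP h y x (mem_filter.1 hy).2.2 hPx)
    · push Not at hex
      rw [sum_eq_zero]
      · exact h0
      · intro x _
        rw [if_neg (fun hx => hex x hx.1 hx.2), mul_zero]
  unfold wsum
  rw [sum_injSeqs_succ]
  simp only [Fin.init_snoc, Fin.snoc_last]
  refine (sum_le_sum key).trans ?_
  rw [sum_add_distrib, ← sum_div]
  simp only [mul_one]
  refine add_le_add_right ?_ _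
  rw [← sum_filter, sum_const, nsmul_eq_mul, mul_one]
  have hsub : (injSeqs L i).filter (fun h => top h < K + i) ⊆
      Fintype.piFinset fun _ => range (K + i) := by
    intro h hh
    rw [Fintype.mem_piFinset]
    exact fun j => mem_range.2 ((term_le_top h j).trans_lt (mem_filter.1 hh).2)
  have := card_le_card hsub
  simp only [Fintype.card_piFinset_const, card_range] at this
  exact_mod_cast this

/-! ### The linear programme -/

/-- The linear programme bounding ordinal stopping rules. -/
theorem sum_mul_le_of_constraint {n : ℕ} (hn : 2 ≤ n) {g : ℕ → ℝ} {Z : ℝ} (hZ : 0 ≤ Z)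
    (hg : ∀ i, 0 ≤ g i)
    (hc : ∀ i, 1 ≤ i → i < n → g i + ∑ j ∈ Ico 1 i, g j / (j + 1) ≤ Z) :
    ∑ i ∈ Ico 1 n, (i : ℝ) * g i ≤ ((n : ℝ) ^ 2 / 4 + n / 2) * Z := by
  -- In terms of `Q` the constraint says that increments are at most `Z`, and summation by parts
  -- turns the objective into `(n - 1) * Q n - 2 * ∑ Q i`.
  set Q : ℕ → ℝ := fun i => i * ∑ j ∈ Ico 1 i, g j / (j + 1) with hQ
  have hQ0 : ∀ i, 0 ≤ Q i := fun i =>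
    mul_nonneg (by positivity) (sum_nonneg fun j _ => div_nonneg (hg j) (by positivity))
  have hstep : ∀ i, 1 ≤ i → Q (i + 1) - Q i = g i + ∑ j ∈ Ico 1 i, g j / (j + 1) := by
    intro i hi
    simp only [hQ]
    rw [sum_Ico_succ_top hi]
    push_cast
    field_simp
    ring
  have hobj : ∀ m : ℕ, 1 ≤ m → ∑ i ∈ Ico 1 m, (i : ℝ) * g i =
      ((m : ℝ) - 1) * Q m - 2 * ∑ i ∈ Ico 1 m, Q i := by
    intro m hm
    induction m, hm using Nat.le_induction with
    | base => simp
    | succ m hm ih =>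
      rw [sum_Ico_succ_top hm, sum_Ico_succ_top hm, ih]
      have h1 := hstep m hm
      have hm' : (0 : ℝ) < m := by exact_mod_cast hm
      have h2 : g m = Q (m + 1) - Q m - Q m / m := by
        rw [h1]; simp only [hQ]; field_simp; ring
      rw [h2]; push_cast; field_simp; ring
  have hd : ∀ d, d < n → Q n - d * Z ≤ Q (n - d) := by
    intro d
    induction d with
    | zero => simp
    | succ d ih =>
      intro hdn
      have h1 := ih (by omega)
      have h2 := hc (n - (d + 1)) (by omega) (by omega)
      rw [← hstep _ (by omega), show n - (d + 1) + 1 = n - d by omega] at h2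
      push_cast
      linarith
  rw [hobj n (by omega)]
  set K := n / 2 with hK
  -- The last `K` terms are bounded below by descending from `Q n` with slope `Z`, the remaining
  -- ones by `0`. With `K = n / 2` the coefficient `n - 1 - 2 * K` of `Q n` is nonpositive, so `Q n`
  -- drops out.
  have hsum : ∑ d ∈ Icc 1 K, (Q n - d * Z) ≤ ∑ i ∈ Ico 1 n, Q i := by
    calc ∑ d ∈ Icc 1 K, (Q n - d * Z) ≤ ∑ d ∈ Icc 1 K, Q (n - d) :=
          sum_le_sum fun d hdK => hd d (by have := mem_Icc.1 hdK; omega)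
      _ = ∑ i ∈ (Icc 1 K).image (fun d => n - d), Q i := by
          rw [sum_image]
          intro a ha b hb hab
          have h1 := mem_Icc.1 (mem_coe.1 ha)
          have h2 := mem_Icc.1 (mem_coe.1 hb)
          simp only at hab
          omega
      _ ≤ _ := by
          refine sum_le_sum_of_subset_of_nonneg ?_ fun i _ _ => hQ0 i
          intro i hi
          obtain ⟨d, hd', rfl⟩ := mem_image.1 hi
          have := mem_Icc.1 hd'
          exact mem_Ico.2 ⟨by omega, by omega⟩
  have hgauss : ∀ (k : ℕ) (q : ℝ),
      ∑ d ∈ Icc 1 k, (q - d * Z) = k * q - k * (k + 1) / 2 * Z := by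
    intro k q
    induction k with
    | zero => simp
    | succ k ih => rw [sum_Icc_succ_top (by omega), ih]; push_cast; ring
  rw [hgauss] at hsum
  have hK1 : (n : ℝ) - 1 - 2 * K ≤ 0 := by
    have : n ≤ 2 * K + 1 := by omega
    have : (n : ℝ) ≤ 2 * K + 1 := by exact_mod_cast this
    linarith
  have hK2 : (K : ℝ) ≤ n / 2 := by
    have : 2 * K ≤ n := by omega
    have : (2 : ℝ) * K ≤ n := by exact_mod_cast this
    linarith
  have hK0 : (0 : ℝ) ≤ K := by positivity
  have h1 := mul_nonpos_of_nonpos_of_nonneg hK1 (hQ0 n)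
  have h2 : (K : ℝ) * (K + 1) * Z ≤ (n / 2) * (n / 2 + 1) * Z := by gcongr
  nlinarith

/-! ### Offers and sales on disjoint intervals -/

namespace Auction

variable {n : ℕ}

theorem disjointProfile_valid {w : Fin n → ℝ} (hw : ∀ j, 0 ≤ w j) (j : Fin n) :
    (disjointProfile w j).Valid := ⟨le_rfl, hw j⟩

theorem disjointProfile_update (w : Fin n → ℝ) (i : Fin n) (y : ℝ) :
    Function.update (disjointProfile w) i { disjointProfile w i with value := y } =
      disjointProfile (Function.update w i y) := by
  ext1 j
  by_cases h : j = i
  · subst h; simp [disjointProfile]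
  · simp [disjointProfile, h]

theorem update_nonneg {w : Fin n → ℝ} (hw : ∀ j, 0 ≤ w j) (i : Fin n) {y : ℝ} (hy : 0 ≤ y)
    (j : Fin n) : 0 ≤ Function.update w i y j := by
  by_cases h : j = i
  · subst h; simpa
  · simpa [h] using hw j

theorem ne_and_arrival_le_iff (w : Fin n → ℝ) (i j : Fin n) :
    (j ≠ i ∧ (disjointProfile w j).arrival ≤ (i : ℝ) + 1) ↔ j < i := by
  simp only [disjointProfile, add_le_add_iff_right, Nat.cast_le]
  rw [Fin.lt_def, ne_eq, Fin.ext_iff]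
  omega

theorem exists_le_of_le_maxSeen {w : Fin n → ℝ} {i : Fin n} {p : ℝ} (hp : 0 < p)
    (h : p ≤ maxSeen (disjointProfile w) i ((i : ℝ) + 1)) : ∃ j < i, p ≤ w j := by
  unfold maxSeen at h
  rw [Finset.le_fold_max] at h
  rcases h with h | ⟨j, hj, h⟩
  · exact absurd hp h.not_gt
  · exact ⟨j, (ne_and_arrival_le_iff w i j).1 (by simpa using hj), h⟩

theorem maxSeen_lt {w : Fin n → ℝ} {i : Fin n} {b : ℝ} (hb : 0 < b) (h : ∀ j < i, w j < b) :
    maxSeen (disjointProfile w) i ((i : ℝ) + 1) < b := by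
  unfold maxSeen
  rw [Finset.fold_max_lt]
  exact ⟨hb, fun j hj => h j ((ne_and_arrival_le_iff w i j).1 (by simpa using hj))⟩

/-- Some value makes bidder `i` win during her active interval. -/
def Offered (M : Auction n) (i : Fin n) (w : Fin n → ℝ) : Prop :=
  ∃ y p : ℝ, 0 ≤ y ∧
    M (disjointProfile (Function.update w i y)) = some (i, (i : ℝ) + 1, p)

theorem IsOnline.eq_of_agree {M : Auction n} (h : M.IsOnline) {w w' : Fin n → ℝ}
    (hw : ∀ j, 0 ≤ w j) (hw' : ∀ j, 0 ≤ w' j) {i : Fin n} {p : ℝ}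
    (hs : M (disjointProfile w) = some (i, (i : ℝ) + 1, p)) (ha : ∀ j ≤ i, w j = w' j) :
    M (disjointProfile w') = some (i, (i : ℝ) + 1, p) := by
  refine h _ _ (disjointProfile_valid hw) (disjointProfile_valid hw') _ _ _ hs fun j hj => ?_
  have hji : j ≤ i := by
    simpa only [disjointProfile, add_le_add_iff_right, Nat.cast_le, or_self, Fin.val_fin_le]
      using hj
  simp [disjointProfile, ha j hji]

/-- A sale at bidder `i`'s time step ignores later reports, and her own value is overwritten, so
only earlier values matter. -/
theorem Offered.congr {M : Auction n} (h : M.IsOnline) {w w' : Fin n → ℝ}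
    (hw : ∀ j, 0 ≤ w j) (hw' : ∀ j, 0 ≤ w' j) {i : Fin n} (ha : ∀ j < i, w j = w' j)
    (ho : Offered M i w) : Offered M i w' := by
  obtain ⟨y, p, hy, hM⟩ := ho
  refine ⟨y, p, hy, h.eq_of_agree (update_nonneg hw i hy) (update_nonneg hw' i hy) hM ?_⟩
  intro j hj
  rcases hj.eq_or_lt with rfl | hj
  · simp
  · simp [hj.ne, ha j hj]

/-- Pretending to have the winning value would bring her a price at most the maximum seen, below her
value. Truthful utility is therefore positive, which only a winner can have. -/
theorem Offered.winner {M : Auction n} (hv : M.IsValueStrategyproof) (hp : M.PricesAtMostMaxSeen)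
    {w : Fin n → ℝ} (hw : ∀ j, 0 ≤ w j) {i : Fin n} (ho : Offered M i w) (hi : 0 < w i)
    (hr : ∀ j < i, w j < w i) : ∃ t p, M (disjointProfile w) = some (i, t, p) := by
  obtain ⟨y, p, hy, hM⟩ := ho
  have h1 := hp _ (disjointProfile_valid (update_nonneg hw i hy)) _ _ _ hM
  have h2 : maxSeen (disjointProfile (Function.update w i y)) i ((i : ℝ) + 1) < w i :=
    maxSeen_lt hi fun j hj => by simpa [hj.ne] using hr j hj
  have h3 := hv _ (disjointProfile_valid hw) i y hy
  rw [disjointProfile_update, hM] at h3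
  have h4 : 0 < (M (disjointProfile w)).utility i (disjointProfile w i) := by
    refine lt_of_lt_of_le ?_ h3
    simp only [Outcome.utility, disjointProfile, le_refl, and_self, if_true]
    linarith
  rcases hm : M (disjointProfile w) with _ | ⟨j, t, q⟩
  · rw [hm] at h4; simp [Outcome.utility] at h4
  · rw [hm] at h4
    by_cases hji : j = i
    · exact ⟨t, q, by rw [hji]⟩
    · simp [Outcome.utility, hji] at h4

/-- Changing the value of the later bidder `i` so that she wins leaves the offer to `j` intact. A
record bidder `j` would then win as well, but there is one item. -/
theorem Offered.not_record {M : Auction n} (hon : M.IsOnline) (hv : M.IsValueStrategyproof)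
    (hp : M.PricesAtMostMaxSeen) {w : Fin n → ℝ} (hw : ∀ j, 0 ≤ w j) {i j : Fin n} (hji : j < i)
    (hi : Offered M i w) (hj : Offered M j w) (h0 : 0 < w j) : ¬ ∀ l < j, w l < w j := by
  intro hr
  obtain ⟨y, p, hy, hM⟩ := hi
  have hw' := update_nonneg hw i hy
  have e : ∀ l ≤ j, Function.update w i y l = w l := fun l hl => by
    simp [(hl.trans_lt hji).ne]
  have h1 : Offered M j (Function.update w i y) :=
    hj.congr hon hw hw' fun l hl => (e l hl.le).symm
  obtain ⟨t, q, h2⟩ := h1.winner hv hp hw' (by rw [e j le_rfl]; exact h0) fun l hl => by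
    rw [e j le_rfl, e l hl.le]; exact hr l hl
  rw [hM] at h2
  simp only [Option.some.injEq, Prod.mk.injEq] at h2
  exact hji.ne h2.1.symm

theorem revenue_pos {M : Auction n} (hir : M.IsIndividuallyRational) {w : Fin n → ℝ}
    (hw : ∀ j, 0 ≤ w j) (h : 0 < (M (disjointProfile w)).revenue) :
    ∃ (i : Fin n) (p : ℝ), M (disjointProfile w) = some (i, (i : ℝ) + 1, p) ∧ 0 < p ∧ p ≤ w i := by
  rcases hm : M (disjointProfile w) with _ | ⟨i, t, p⟩
  · rw [hm] at h; simp [Outcome.revenue] at h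
  · rw [hm] at h
    simp only [Outcome.revenue] at h
    have h1 := hir _ (disjointProfile_valid hw) i
    rw [hm] at h1
    simp only [Outcome.utility, if_true] at h1
    split_ifs at h1 with ht
    · have : t = (i : ℝ) + 1 := le_antisymm ht.2 ht.1
      have h2 : 0 ≤ w i - p := h1
      exact ⟨i, p, by rw [this], h, by linarith⟩
    · linarith

theorem price_le_of_update {M : Auction n} (hv : M.IsValueStrategyproof) {w : Fin n → ℝ}
    (hw : ∀ j, 0 ≤ w j) {i : Fin n} {y p q : ℝ} (hy : 0 ≤ y)
    (h1 : M (disjointProfile w) = some (i, (i : ℝ) + 1, p))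
    (h2 : M (disjointProfile (Function.update w i y)) = some (i, (i : ℝ) + 1, q)) : p ≤ q := by
  have h3 := hv _ (disjointProfile_valid hw) i y hy
  rw [disjointProfile_update, h1, h2] at h3
  simp only [Outcome.utility, disjointProfile, le_refl, and_self, if_true] at h3
  linarith

/-- The values `b ^ h j` of the first bidders, followed by zeros. -/
noncomputable def extVals (n b : ℕ) {m : ℕ} (h : Fin m → ℕ) : Fin n → ℝ :=
  fun j => if hj : (j : ℕ) < m then (b : ℝ) ^ h ⟨j, hj⟩ else 0

theorem extVals_nonneg {b m : ℕ} (h : Fin m → ℕ) (j : Fin n) : 0 ≤ extVals n b h j := by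
  unfold extVals; split_ifs <;> positivity

theorem extVals_pre {b m : ℕ} (hm : m ≤ n) (s : Fin n → ℕ) {j : Fin n} (hj : (j : ℕ) < m) :
    extVals n b (pre hm s) j = (b : ℝ) ^ s j := by
  simp only [extVals, dif_pos hj]
  rfl

open Classical in
/-- Indicator of an offer to bidder `i`, as a function of the exponents of the earlier values. -/
noncomputable def offerInd (M : Auction n) (b : ℕ) (i : Fin n) (h : Fin i → ℕ) : ℝ :=
  if Offered M i (extVals n b h) then 1 else 0

/-- Bidder `i` wins for a price in `(b ^ (x - 1), b ^ x]`, where `b ^ x` is her value. -/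
def SoldNearValue (M : Auction n) (b : ℕ) (i : Fin n) (h : Fin (i + 1) → ℕ) : Prop :=
  ∃ p : ℝ, M (disjointProfile (extVals n b h)) = some (i, (i : ℝ) + 1, p) ∧
    p ≤ (b : ℝ) ^ h (Fin.last i) ∧ (b : ℝ) ^ h (Fin.last i) < p * b

theorem offered_iff {M : Auction n} (hon : M.IsOnline) {b : ℕ} (i : Fin n) (s : Fin n → ℕ) :
    Offered M i (fun j => (b : ℝ) ^ s j) ↔ Offered M i (extVals n b (pre i.2.le s)) := by
  have h1 : ∀ j : Fin n, (0 : ℝ) ≤ (b : ℝ) ^ s j := fun j => by positivity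
  have h2 : ∀ j < i, (b : ℝ) ^ s j = extVals n b (pre i.2.le s) j := fun j hj =>
    (extVals_pre i.2.le s hj).symm
  exact ⟨Offered.congr hon h1 (extVals_nonneg _) h2,
    Offered.congr hon (extVals_nonneg _) h1 fun j hj => (h2 j hj).symm⟩

/-- For a fixed history all winning values at this time step pay the same price, and the ranges `(b
^ (x - 1), b ^ x]` are disjoint. -/
theorem SoldNearValue.unique {M : Auction n} (hv : M.IsValueStrategyproof) {b : ℕ} (hb : 2 ≤ b)
    {i : Fin n} {h : Fin i → ℕ} {x y : ℕ} (hx : SoldNearValue M b i (app h x))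
    (hy : SoldNearValue M b i (app h y)) : x = y := by
  obtain ⟨p, h1, h2, h3⟩ := hx
  obtain ⟨q, h4, h5, h6⟩ := hy
  simp only [Fin.snoc_last] at h2 h3 h5 h6
  have e : ∀ x y : ℕ, extVals n b (app h y) =
      Function.update (extVals n b (app h x)) i ((b : ℝ) ^ y) := by
    intro x y
    ext j
    rcases lt_trichotomy j i with hj | rfl | hj
    · have hj' : (j : ℕ) < i := hj
      have hj2 : (j : ℕ) < i + 1 := by omega
      rw [Function.update_of_ne hj.ne]
      simp [extVals, hj2, Fin.snoc, hj']
    · simp [extVals, Fin.snoc]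
    · have hj2 : ¬ (j : ℕ) < i + 1 := by have : (i : ℕ) < j := hj; omega
      rw [Function.update_of_ne hj.ne']
      simp [extVals, hj2]
  have hb1 : (1 : ℝ) < b := by exact_mod_cast hb
  have key : ∀ x y : ℕ, ∀ p q : ℝ,
      M (disjointProfile (extVals n b (app h x))) = some (i, (i : ℝ) + 1, p) →
      M (disjointProfile (extVals n b (app h y))) = some (i, (i : ℝ) + 1, q) →
      (b : ℝ) ^ x < p * b → q ≤ (b : ℝ) ^ y → x ≤ y := by
    intro x y p q hp hq h7 h8
    rw [e x y] at hq
    have h9 := price_le_of_update hv (extVals_nonneg _) (by positivity) hp hq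
    have h10 : (b : ℝ) ^ x < (b : ℝ) ^ (y + 1) := by
      rw [pow_succ]
      refine h7.trans_le (mul_le_mul_of_nonneg_right (h9.trans h8) (by linarith))
    exact Nat.lt_succ_iff.1 ((pow_lt_pow_iff_right₀ hb1).1 h10)
  exact le_antisymm (key x y p q h1 h4 h3 h5) (key y x q p h4 h1 h6 h2)

end Auction

/-! ### Revenue against the second largest value -/

/-- The second largest term of an injective sequence. -/
def sec {n : ℕ} (s : Fin n → ℕ) : ℕ := (univ.filter fun j => s j < top s).sup s

theorem le_sec {n : ℕ} {s : Fin n → ℕ} {j : Fin n} (h : s j < top s) : s j ≤ sec s :=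
  Finset.le_sup (f := s) (mem_filter.2 ⟨mem_univ _, h⟩)

theorem sec_comp {n : ℕ} (s : Fin n → ℕ) (π : Equiv.Perm (Fin n)) : sec (s ∘ π) = sec s := by
  unfold sec
  rw [top_comp]
  apply le_antisymm
  · exact Finset.sup_le fun j hj => le_sec (s := s) (mem_filter.1 hj).2
  · refine Finset.sup_le fun j hj => ?_
    have := Finset.le_sup (f := s ∘ π) (s := univ.filter fun j => (s ∘ π) j < top s)
      (b := π.symm j) (by simpa using hj)
    simpa using this

theorem sec_eq_of_strictAnti {n : ℕ} (hn : 2 ≤ n) {s : Fin n → ℕ} (hs : StrictAnti s) :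
    sec s = s ⟨1, hn⟩ := by
  have h0 : top s = s ⟨0, by omega⟩ :=
    le_antisymm (Finset.sup_le fun j _ => hs.antitone (by simp [Fin.le_def])) (term_le_top s _)
  apply le_antisymm
  · refine Finset.sup_le fun j hj => ?_
    have h1 := (mem_filter.1 hj).2
    rw [h0] at h1
    have h2 := hs.lt_iff_gt.1 h1
    exact hs.antitone (by rw [Fin.le_def]; rw [Fin.lt_def] at h2; exact h2)
  · refine le_sec ?_
    rw [h0]
    exact hs (by simp [Fin.lt_def])

namespace Auction
variable {n : ℕ}

/-- All bidders but the first one. -/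
abbrev laterBidders (n : ℕ) : Finset (Fin n) := univ.filter fun i => 1 ≤ (i : ℕ)

-- The three terms stand for a sale to the largest bidder, a sale to the second largest bidder near
-- her value, and a revenue of at most `b ^ sec s / b`.
open Classical in
theorem revenue_le {M : Auction n} (hon : M.IsOnline) (hir : M.IsIndividuallyRational)
    (hp : M.PricesAtMostMaxSeen) {b : ℕ} (hb : 2 ≤ b) {s : Fin n → ℕ} (hs : Function.Injective s) :
    (M (disjointProfile fun j => (b : ℝ) ^ s j)).revenue ≤ (b : ℝ) ^ sec s *
      (∑ i ∈ laterBidders n,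
          (if TopTwoAt i s then offerInd M b i (pre i.2.le s) else 0) +
        ∑ i ∈ laterBidders n, (if s i ≤ top (pre i.2.le s) ∧
          SoldNearValue M b i (pre (Nat.succ_le_of_lt i.2) s) then 1 else 0) + 1 / b) := by
  set w : Fin n → ℝ := fun j => (b : ℝ) ^ s j with hw
  have hb1 : (1 : ℝ) < b := by exact_mod_cast hb
  have hb0 : (0 : ℝ) < b := by linarith
  have hw0 : ∀ j, 0 ≤ w j := fun j => by positivity
  have hA : ∀ i : Fin n, 0 ≤ (if TopTwoAt i s then offerInd M b i (pre i.2.le s) else 0) := by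
    intro i; unfold offerInd; split_ifs <;> norm_num
  have hB : ∀ i : Fin n, 0 ≤ (if s i ≤ top (pre i.2.le s) ∧
      SoldNearValue M b i (pre (Nat.succ_le_of_lt i.2) s) then (1 : ℝ) else 0) := by
    intro i; split_ifs <;> norm_num
  set SA := ∑ i ∈ laterBidders n,
    (if TopTwoAt i s then offerInd M b i (pre i.2.le s) else 0) with hSA
  set SB := ∑ i ∈ laterBidders n, (if s i ≤ top (pre i.2.le s) ∧
    SoldNearValue M b i (pre (Nat.succ_le_of_lt i.2) s) then (1 : ℝ) else 0) with hSB
  have hSA0 : 0 ≤ SA := sum_nonneg fun i _ => hA i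
  have hSB0 : 0 ≤ SB := sum_nonneg fun i _ => hB i
  have hsec0 : (0 : ℝ) < (b : ℝ) ^ sec s := by positivity
  by_cases hlow : (M (disjointProfile w)).revenue ≤ (b : ℝ) ^ sec s * (1 / b)
  · refine hlow.trans (mul_le_mul_of_nonneg_left ?_ hsec0.le)
    linarith
  push Not at hlow
  have hpos : 0 < (M (disjointProfile w)).revenue := lt_of_le_of_lt (by positivity) hlow
  obtain ⟨i, p, hM, hp0, hpw⟩ := revenue_pos hir hw0 hpos
  have hrev : (M (disjointProfile w)).revenue = p := by rw [hM]; rfl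
  rw [hrev] at hlow ⊢
  obtain ⟨l, hli, hpl⟩ := exists_le_of_le_maxSeen hp0 (hp _ (disjointProfile_valid hw0) _ _ _ hM)
  have hi1 : 1 ≤ (i : ℕ) := by have : (l : ℕ) < i := hli; omega
  have hlow' : (b : ℝ) ^ sec s < p * b := by
    rw [mul_one_div, div_lt_iff₀ hb0] at hlow; exact hlow
  have hge : ∀ j, p ≤ w j → sec s ≤ s j := by
    intro j hj
    have : (b : ℝ) ^ sec s < (b : ℝ) ^ (s j + 1) := by
      rw [pow_succ]; exact hlow'.trans_le (mul_le_mul_of_nonneg_right hj hb0.le)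
    exact Nat.lt_succ_iff.1 ((pow_lt_pow_iff_right₀ hb1).1 this)
  have hsi := hge i hpw
  have hsl := hge l hpl
  have htop : ∀ j, s j ≤ sec s ∨ s j = top s := fun j => by
    rcases (term_le_top s j).lt_or_eq with h | h
    · exact Or.inl (le_sec h)
    · exact Or.inr h
  have hle_pre : ∀ j < i, s j ≤ top (pre i.2.le s) := fun j hj =>
    term_le_top (pre i.2.le s) ⟨j, hj⟩
  suffices h : p ≤ (b : ℝ) ^ sec s ∧ 1 ≤ SA + SB by
    calc p ≤ (b : ℝ) ^ sec s * 1 := by rw [mul_one]; exact h.1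
      _ ≤ _ := mul_le_mul_of_nonneg_left (by have : 0 ≤ 1 / (b : ℝ) := by positivity
                                             linarith [h.2]) hsec0.le
  have hmem : i ∈ laterBidders n := mem_filter.2 ⟨mem_univ _, hi1⟩
  -- Both the winner `i` and the earlier bidder `l` with value at least `p` have exponent at least
  -- `sec s`, so they are the top two; their order decides the case.
  rcases lt_or_gt_of_ne (hs.ne hli.ne) with hlt | hgt
  · have hl : s l = sec s := le_antisymm (le_sec (hlt.trans_le (term_le_top s i))) hsl
    have hit : s i = top s := (htop i).resolve_left (by omega)
    refine ⟨by rw [← hl]; exact hpl, ?_⟩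
    have hA1 : 1 ≤ SA := by
      refine le_trans ?_ (single_le_sum (fun j _ => hA j) hmem)
      have hT : TopTwoAt i s := by
        refine ⟨fun j hj => ?_, fun j hj => ?_⟩
        · rw [hit]
          exact lt_of_le_of_ne (term_le_top s j) fun h => hs.ne hj.ne (h.trans hit.symm)
        · have h1 : s j ≤ sec s := (htop j).resolve_right fun h =>
            hs.ne hj.ne' (h.trans hit.symm)
          rw [← hl] at h1
          exact h1.trans (hle_pre l hli)
      have hO : Offered M i w := ⟨w i, p, hw0 i, by rw [Function.update_eq_self]; exact hM⟩
      rw [if_pos hT, offerInd, if_pos ((offered_iff hon i s).1 hO)]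
    linarith
  · have hi : s i = sec s := le_antisymm (le_sec (hgt.trans_le (term_le_top s l))) hsi
    refine ⟨by rw [← hi]; exact hpw, ?_⟩
    have hB1 : 1 ≤ SB := by
      refine le_trans ?_ (single_le_sum (fun j _ => hB j) hmem)
      rw [if_pos]
      refine ⟨hgt.le.trans (hle_pre l hli), p, ?_, ?_, ?_⟩
      · refine hon.eq_of_agree hw0 (extVals_nonneg _) hM fun j hj => ?_
        exact (extVals_pre _ s (Nat.lt_succ_of_le hj)).symm
      · exact hpw
      · change (b : ℝ) ^ s i < p * b
        rw [hi]; exact hlow'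
    linarith

end Auction

/-! ### Averaging over histories and over the seed -/

namespace Auction

variable {n : ℕ}

theorem offerInd_nonneg (M : Auction n) (b : ℕ) (i : Fin n) (h : Fin i → ℕ) :
    0 ≤ offerInd M b i h := by unfold offerInd; split_ifs <;> norm_num

theorem offerInd_le_one (M : Auction n) (b : ℕ) (i : Fin n) (h : Fin i → ℕ) :
    offerInd M b i h ≤ 1 := by unfold offerInd; split_ifs <;> norm_num

theorem wsum_nonneg {L i : ℕ} {Φ : (Fin i → ℕ) → ℝ} (h : ∀ s, 0 ≤ Φ s) : 0 ≤ wsum L Φ :=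
  sum_nonneg fun s _ => mul_nonneg (wt_nonneg s) (h s)

theorem wsum_sum {L i : ℕ} {ι : Type*} (S : Finset ι) (Φ : ι → (Fin i → ℕ) → ℝ) :
    wsum L (fun s => ∑ j ∈ S, Φ j s) = ∑ j ∈ S, wsum L (Φ j) := by
  simp only [wsum, mul_sum]
  exact sum_comm

open Classical in
/-- Indicator of an offer to bidder `j` who turns out to have a record value. -/
noncomputable def recordInd (M : Auction n) (b : ℕ) (j : Fin n) (s : Fin (j + 1) → ℕ) : ℝ :=
  if top (ini s) < s (Fin.last j) then offerInd M b j (ini s) else 0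

theorem recordInd_le_one (M : Auction n) (b : ℕ) (j : Fin n) (s : Fin (j + 1) → ℕ) :
    recordInd M b j s ≤ 1 := by
  unfold recordInd; split_ifs
  · exact offerInd_le_one _ _ _ _
  · norm_num

theorem recordInd_eq_zero_or_one (M : Auction n) (b : ℕ) (j : Fin n) (s : Fin (j + 1) → ℕ) :
    recordInd M b j s = 0 ∨ recordInd M b j s = 1 := by
  unfold recordInd offerInd; split_ifs <;> simp

theorem offered_and_record_of_recordInd {M : Auction n} (hon : M.IsOnline) {b : ℕ} (hb : 2 ≤ b)
    {j : Fin n} {s : Fin n → ℕ} (h : recordInd M b j (pre (Nat.succ_le_of_lt j.2) s) = 1) :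
    Offered M j (fun l => (b : ℝ) ^ s l) ∧ ∀ l < j, (b : ℝ) ^ s l < (b : ℝ) ^ s j := by
  have hb1 : (1 : ℝ) < b := by exact_mod_cast hb
  unfold recordInd offerInd at h
  split_ifs at h with h1 h2
  · refine ⟨(offered_iff hon j s).2 h2, fun l hl => pow_lt_pow_right₀ hb1 ?_⟩
    exact (term_le_top (pre j.2.le s) ⟨l, hl⟩).trans_lt h1
  · simp at h
  · simp at h

/-- The events "offer to `i`" and "offered record at `j`", for `j < i`, are pairwise exclusive by
`Offered.not_record`. -/
theorem sum_recordInd_le_one {M : Auction n} (hon : M.IsOnline) (hv : M.IsValueStrategyproof)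
    (hp : M.PricesAtMostMaxSeen) {b : ℕ} (hb : 2 ≤ b) (i : Fin n) (s : Fin n → ℕ) :
    offerInd M b i (pre i.2.le s) + ∑ j ∈ (laterBidders n).filter (· < i),
      recordInd M b j (pre (Nat.succ_le_of_lt j.2) s) ≤ 1 := by
  have hb0 : 0 < b := by omega
  have hw0 : ∀ j, (0 : ℝ) ≤ (b : ℝ) ^ s j := fun j => by positivity
  have hexcl : ∀ i j : Fin n, j < i → Offered M i (fun l => (b : ℝ) ^ s l) →
      recordInd M b j (pre (Nat.succ_le_of_lt j.2) s) = 0 := by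
    intro i j hji hO
    refine (recordInd_eq_zero_or_one M b j _).resolve_right fun h => ?_
    obtain ⟨h1, h2⟩ := offered_and_record_of_recordInd hon hb h
    exact Offered.not_record hon hv hp hw0 hji hO h1 (by positivity) h2
  by_cases hO : Offered M i (fun l => (b : ℝ) ^ s l)
  · rw [sum_eq_zero fun j hj => hexcl i j (mem_filter.1 hj).2 hO, add_zero]
    exact offerInd_le_one _ _ _ _
  · have h0 : offerInd M b i (pre i.2.le s) = 0 := by
      unfold offerInd; rw [if_neg fun h => hO ((offered_iff hon i s).2 h)]
    rw [h0, zero_add]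
    by_cases hex : ∃ j ∈ (laterBidders n).filter (· < i),
        recordInd M b j (pre (Nat.succ_le_of_lt j.2) s) = 1
    · obtain ⟨j, hj, h1⟩ := hex
      rw [sum_eq_single_of_mem j hj, h1]
      intro l _ hlj
      rcases lt_or_gt_of_ne hlj with h | h
      · exact hexcl j l h (offered_and_record_of_recordInd hon hb h1).1
      · refine (recordInd_eq_zero_or_one M b l _).resolve_right fun h2 => ?_
        have := hexcl l j h (offered_and_record_of_recordInd hon hb h2).1
        rw [h1] at this
        exact one_ne_zero this
    · push Not at hex
      rw [sum_eq_zero fun j hj => (recordInd_eq_zero_or_one M b j _).resolve_right (hex j hj)]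
      exact zero_le_one

/-- Each marginal costs at most `n` and each record step at most `1`, in total `n + n * (1 + n) ≤ 3
* n ^ 2`. -/
theorem offer_constraint {M : Auction n} (hon : M.IsOnline) (hv : M.IsValueStrategyproof)
    (hp : M.PricesAtMostMaxSeen) {b : ℕ} (hb : 2 ≤ b) (L : ℕ) (i : Fin n) (hi : 1 ≤ (i : ℕ)) :
    wsum L (offerInd M b i) + ∑ j ∈ (laterBidders n).filter (· < i),
      wsum L (offerInd M b j) / ((j : ℝ) + 1) ≤
        wsum L (fun _ : Fin n → ℕ => 1) + 3 * (n : ℝ) ^ 2 := by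
  have h1 := wsum_mono (L := L) fun s _ => sum_recordInd_le_one hon hv hp hb i s
  rw [wsum_add, wsum_sum] at h1
  have hn1 : (1 : ℝ) ≤ n := by exact_mod_cast hi.trans i.2.le
  have h2 := le_wsum_pre (L := L) hi i.2.le (offerInd_le_one M b i)
  have h3 : ((n - (i : ℕ) : ℕ) : ℝ) ≤ n := by exact_mod_cast Nat.sub_le _ _
  have h4 : ∀ j ∈ (laterBidders n).filter (· < i),
      wsum L (offerInd M b j) / ((j : ℝ) + 1) - (1 + n) ≤
        wsum L (fun s : Fin n → ℕ => recordInd M b j (pre (Nat.succ_le_of_lt j.2) s)) := by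
    intro j hj
    have hj1 : 1 ≤ (j : ℕ) := (mem_filter.1 (mem_filter.1 hj).1).2
    have h5 := le_wsum_pre (L := L) (Nat.le_add_left 1 j) (Nat.succ_le_of_lt j.2)
      (recordInd_le_one M b j)
    have h6 := le_wsum_record (L := L) hj1 (offerInd_le_one M b j)
    have h7 : ((n - ((j : ℕ) + 1) : ℕ) : ℝ) ≤ n := by exact_mod_cast Nat.sub_le _ _
    have hj' : (1 : ℝ) ≤ (j : ℝ) := by exact_mod_cast hj1
    have h8 : 1 / ((j : ℝ) * (j + 1)) ≤ 1 := by
      rw [div_le_one (by positivity)]; nlinarith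
    rw [one_div_mul_eq_div] at h6
    have h9 : wsum L (offerInd M b j) / ((j : ℝ) + 1) - 1 ≤ wsum L (recordInd M b j) := by
      refine le_trans ?_ h6
      linarith
    linarith
  have h5 := sum_le_sum h4
  rw [sum_sub_distrib, sum_const, nsmul_eq_mul] at h5
  have h6 : (((laterBidders n).filter (· < i)).card : ℝ) ≤ n := by
    have := card_le_univ ((laterBidders n).filter (· < i))
    rw [Fintype.card_fin] at this
    exact_mod_cast this
  have h7 : (((laterBidders n).filter (· < i)).card : ℝ) * (1 + n) ≤ n * (1 + n) :=
    mul_le_mul_of_nonneg_right h6 (by positivity)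
  nlinarith

theorem sum_laterBidders (f : ℕ → ℝ) : ∑ i ∈ laterBidders n, f i = ∑ i ∈ Ico 1 n, f i := by
  rw [sum_filter, Fin.sum_univ_eq_sum_range (fun i => if 1 ≤ i then f i else 0), ← sum_filter]
  congr 1
  ext; simp; omega

theorem sum_offers_le {M : Auction n} (hn : 2 ≤ n) (hon : M.IsOnline)
    (hv : M.IsValueStrategyproof) (hp : M.PricesAtMostMaxSeen) {b : ℕ} (hb : 2 ≤ b) (L : ℕ) :
    ∑ i ∈ laterBidders n, (i : ℝ) * wsum L (offerInd M b i) ≤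
      ((n : ℝ) ^ 2 / 4 + n / 2) * (wsum L (fun _ : Fin n → ℕ => 1) + 3 * (n : ℝ) ^ 2) := by
  set g : ℕ → ℝ := fun i => if hi : i < n then wsum L (offerInd M b ⟨i, hi⟩) else 0 with hg
  have hgi : ∀ i : Fin n, g i = wsum L (offerInd M b i) := fun i => by simp [hg]
  have hZ : 0 ≤ wsum L (fun _ : Fin n → ℕ => 1) + 3 * (n : ℝ) ^ 2 :=
    add_nonneg (wsum_nonneg fun _ => zero_le_one) (by positivity)
  have key := sum_mul_le_of_constraint hn hZ (g := g) ?_ ?_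
  · rw [← sum_laterBidders fun i => (i : ℝ) * g i] at key
    simpa only [hgi] using key
  · intro i
    simp only [hg]
    split_ifs
    · exact wsum_nonneg fun s => offerInd_nonneg M b ⟨i, _⟩ s
    · exact le_rfl
  · intro i hi hin
    have h1 := offer_constraint hon hv hp hb L ⟨i, hin⟩ hi
    have h2 : ∑ j ∈ Ico 1 i, g j / ((j : ℝ) + 1) =
        ∑ j ∈ (laterBidders n).filter (· < ⟨i, hin⟩),
          wsum L (offerInd M b j) / ((j : ℝ) + 1) := by
      have h3 : ∀ j : Fin n, j < ⟨i, hin⟩ ↔ (j : ℕ) < i := fun j => Iff.rfl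
      simp only [← hgi, h3]
      rw [sum_filter, sum_laterBidders fun j => if j < i then g j / ((j : ℝ) + 1) else 0, ← sum_filter]
      congr 1
      ext j; simp; omega
    rw [h2, ← hgi] at *
    exact h1

-- With base `n` the excess over `1 / 4` is `3 / 2` (linear programme) `+ 1` (near-value sales) `+
-- 1` (low revenue) `+ 1` (bounded errors, absorbed by `hL`), in units of `1 / n`; `5` is a
-- rounding.
open Classical in
theorem wsum_ratio_le {M : Auction n} (hn : 2 ≤ n) (hon : M.IsOnline)
    (hv : M.IsValueStrategyproof) (hir : M.IsIndividuallyRational) (hp : M.PricesAtMostMaxSeen)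
    {L : ℕ} (hL : (n : ℝ) * (3 * n ^ 2 + 1 + n * ((n ^ 2 + n : ℕ) : ℝ) ^ n) ≤
      wsum L (fun _ : Fin n → ℕ => 1)) :
    wsum L (fun s : Fin n → ℕ =>
      (M (disjointProfile fun j => (n : ℝ) ^ s j)).revenue / (n : ℝ) ^ sec s) ≤
        (1 / 4 + 5 / n) * wsum L (fun _ : Fin n → ℕ => 1) := by
  set Z := wsum L (fun _ : Fin n → ℕ => 1) with hZ
  have hn2 : (2 : ℝ) ≤ n := by exact_mod_cast hn
  have hn0 : (0 : ℝ) < n := by linarith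
  have hZ0 : 0 ≤ Z := wsum_nonneg fun _ => zero_le_one
  set R : ℝ := ((n ^ 2 + n : ℕ) : ℝ) ^ n with hR
  have hA : ∀ i ∈ laterBidders n, wsum L (fun s : Fin n → ℕ =>
      if TopTwoAt i s then offerInd M n i (pre i.2.le s) else 0) ≤
        1 / ((n : ℝ) * (n - 1)) * (i * wsum L (offerInd M n i)) := by
    intro i hi
    refine (wsum_topTwoAt_le i (mem_filter.1 hi).2 (offerInd_nonneg M n i)).trans (le_of_eq ?_)
    ring
  have hB : ∀ i ∈ laterBidders n, wsum L (fun s : Fin n → ℕ =>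
      if s i ≤ top (pre i.2.le s) ∧ SoldNearValue M n i (pre (Nat.succ_le_of_lt i.2) s)
        then 1 else 0) ≤ (Z + n) / n ^ 2 + R := by
    intro i hi
    have hi1 := (mem_filter.1 hi).2
    have h1 := wsum_pre_le (L := L) (Nat.le_add_left 1 i) (Nat.succ_le_of_lt i.2)
      (Φ := fun s : Fin (i + 1) → ℕ =>
        if s (Fin.last i) ≤ top (ini s) ∧ SoldNearValue M n i s then 1 else 0)
      fun s => by split_ifs <;> norm_num
    -- `K = n ^ 2` makes the near-value sales of at most `n` bidders amount to about `Z / n`.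
    have h2 := wsum_nonrecord_unique_le (L := L) hi1 (K := n ^ 2)
      (Nat.one_le_pow _ _ (by omega))
      (SoldNearValue M n i) fun h x y => SoldNearValue.unique hv hn
    have h3 := le_wsum_pre (L := L) hi1 i.2.le (Φ := fun _ => 1) fun _ => le_rfl
    have h4 : ((n - (i : ℕ) : ℕ) : ℝ) ≤ n := by exact_mod_cast Nat.sub_le _ _
    refine h1.trans (h2.trans (add_le_add ?_ ?_))
    · push_cast
      exact div_le_div_of_nonneg_right (by linarith) (by positivity)
    · have h5 : (n ^ 2 + i) ^ (i : ℕ) ≤ (n ^ 2 + n) ^ n :=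
        (Nat.pow_le_pow_left (by have := i.2; omega) _).trans
          (Nat.pow_le_pow_right (by positivity) i.2.le)
      rw [hR]
      exact_mod_cast h5
  have hcard : ((laterBidders n).card : ℝ) ≤ n := by
    have := card_le_univ (laterBidders n)
    rw [Fintype.card_fin] at this
    exact_mod_cast this
  have hR0 : 0 ≤ R := by positivity
  have h1 : wsum L (fun s : Fin n → ℕ =>
      (M (disjointProfile fun j => (n : ℝ) ^ s j)).revenue / (n : ℝ) ^ sec s) ≤
      wsum L (fun s : Fin n → ℕ => ∑ i ∈ laterBidders n,
          (if TopTwoAt i s then offerInd M n i (pre i.2.le s) else 0) +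
        ∑ i ∈ laterBidders n, (if s i ≤ top (pre i.2.le s) ∧
          SoldNearValue M n i (pre (Nat.succ_le_of_lt i.2) s) then 1 else 0) + 1 / n) := by
    refine wsum_mono fun s hs => ?_
    rw [div_le_iff₀ (by positivity), mul_comm _ ((n : ℝ) ^ sec s)]
    exact revenue_le hon hir hp hn (mem_injSeqs.1 hs).2
  rw [wsum_add, wsum_add, wsum_sum, wsum_sum] at h1
  have h2 := sum_le_sum hA
  have h3 := sum_le_sum hB
  rw [← mul_sum] at h2
  rw [sum_const, nsmul_eq_mul] at h3
  have h4 := sum_offers_le hn hon hv hp hn L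
  rw [← hZ] at h4
  have h5 : wsum L (fun _ : Fin n → ℕ => 1 / (n : ℝ)) = Z / n := by
    rw [hZ]; unfold wsum; rw [sum_div]; exact sum_congr rfl fun _ _ => by ring
  have h6 : 1 / ((n : ℝ) * (n - 1)) * (((n : ℝ) ^ 2 / 4 + n / 2) * (Z + 3 * (n : ℝ) ^ 2)) ≤
      (1 / 4 + 3 / (2 * n)) * (Z + 3 * n ^ 2) := by
    rw [← mul_assoc]
    refine mul_le_mul_of_nonneg_right ?_ (by positivity)
    have : (0 : ℝ) < n - 1 := by linarith
    rw [one_div_mul_eq_div, div_le_iff₀ (by positivity)]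
    have e : (1 / 4 + 3 / (2 * (n : ℝ))) * (n * (n - 1)) = (n / 4 + 3 / 2) * (n - 1) := by
      field_simp
    rw [e]
    nlinarith
  have h7 : 1 / ((n : ℝ) * (n - 1)) * ∑ i ∈ laterBidders n, (i : ℝ) * wsum L (offerInd M n i) ≤
      1 / ((n : ℝ) * (n - 1)) * (((n : ℝ) ^ 2 / 4 + n / 2) * (Z + 3 * (n : ℝ) ^ 2)) :=
    mul_le_mul_of_nonneg_left h4 (by have : (0 : ℝ) < n - 1 := by linarith
                                     positivity)
  have h8 : ((laterBidders n).card : ℝ) * ((Z + n) / n ^ 2 + R) ≤ n * ((Z + n) / n ^ 2 + R) :=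
    mul_le_mul_of_nonneg_right hcard (by positivity)
  have h9 : (n : ℝ) * ((Z + n) / n ^ 2 + R) = Z / n + 1 + n * R := by field_simp
  have h10 : 3 * (n : ℝ) ^ 2 + 1 + n * R ≤ Z / n := by rw [le_div_iff₀ hn0]; linarith
  have h11 : 1 / 4 + 3 / (2 * (n : ℝ)) ≤ 1 := by
    have : 3 / (2 * (n : ℝ)) ≤ 3 / 4 := by
      rw [div_le_div_iff₀ (by positivity) (by norm_num)]; linarith
    linarith
  have h12 : (1 / 4 + 3 / (2 * (n : ℝ))) * (3 * n ^ 2) ≤ 1 * (3 * n ^ 2) :=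
    mul_le_mul_of_nonneg_right h11 (by positivity)
  have h13 : 3 / (2 * (n : ℝ)) * Z = 3 / 2 * (Z / n) := by field_simp
  have h14 : (5 : ℝ) / n * Z = 5 * (Z / n) := by field_simp
  have h15 : 0 ≤ Z / n := by positivity
  rw [h5] at h1
  rw [add_mul, h14]
  have h16 : (1 / 4 + 3 / (2 * (n : ℝ))) * (Z + 3 * n ^ 2) =
      1 / 4 * Z + 3 / 2 * (Z / n) + (1 / 4 + 3 / (2 * (n : ℝ))) * (3 * n ^ 2) := by
    rw [← h13]; ring
  rw [h16] at h6
  linarith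

/-- The weights and `sec` are invariant under permutations, so the random assignment is already
built into the weighted total. -/
theorem wsum_expectedRevenue (M : Auction n) (L b : ℕ) :
    wsum L (fun s : Fin n → ℕ => M.expectedRevenue (fun j => (b : ℝ) ^ s j) / (b : ℝ) ^ sec s) =
      wsum L (fun s : Fin n → ℕ =>
        (M (disjointProfile fun j => (b : ℝ) ^ s j)).revenue / (b : ℝ) ^ sec s) := by
  set F : (Fin n → ℕ) → ℝ := fun s =>
    (M (disjointProfile fun j => (b : ℝ) ^ s j)).revenue / (b : ℝ) ^ sec s with hF
  have h1 : ∀ s : Fin n → ℕ, M.expectedRevenue (fun j => (b : ℝ) ^ s j) / (b : ℝ) ^ sec s =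
      ∑ π : Equiv.Perm (Fin n), F (s ∘ π) / n.factorial := by
    intro s
    simp only [hF, sec_comp, expectedRevenue, ← sum_div]
    rw [div_right_comm]
    rfl
  have h2 : ∀ π : Equiv.Perm (Fin n), wsum L (fun s => F (s ∘ π) / n.factorial) =
      wsum L F / n.factorial := by
    intro π
    unfold wsum
    rw [← sum_injSeqs_comp (fun s => wt s * F s) π, sum_div]
    exact sum_congr rfl fun s _ => by rw [wt_comp]; ring
  simp only [h1]
  rw [wsum_sum, sum_congr rfl fun π _ => h2 π, sum_const, nsmul_eq_mul, card_univ,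
    Fintype.card_perm, Fintype.card_fin]
  have : (n.factorial : ℝ) ≠ 0 := by exact_mod_cast n.factorial_ne_zero
  field_simp

theorem expectedRevenue_comp (M : Auction n) (v : Fin n → ℝ) (σ : Equiv.Perm (Fin n)) :
    M.expectedRevenue (v ∘ σ) = M.expectedRevenue v := by
  unfold expectedRevenue
  congr 1
  exact Fintype.sum_equiv (Equiv.mulLeft σ) _ _ fun π => rfl

theorem exists_strictAnti_comp {s : Fin n → ℕ} (hs : Function.Injective s) :
    ∃ π : Equiv.Perm (Fin n), StrictAnti (s ∘ π) := by
  refine ⟨Fin.revPerm.trans (Tuple.sort s), ?_⟩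
  have h1 : StrictMono (s ∘ Tuple.sort s) :=
    (Tuple.monotone_sort s).strictMono_of_injective (hs.comp (Tuple.sort s).injective)
  intro a b hab
  exact h1 (Fin.rev_lt_rev.2 hab)

theorem exists_values_expectedRevenue_le (hn : 2 ≤ n) {Ω : Type*} [MeasurableSpace Ω]
    (P : Measure Ω) [IsProbabilityMeasure P] (M : Ω → Auction n) (hon : ∀ ω, (M ω).IsOnline)
    (hv : ∀ ω, (M ω).IsValueStrategyproof) (hir : ∀ ω, (M ω).IsIndividuallyRational)
    (hp : ∀ ω, (M ω).PricesAtMostMaxSeen) :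
    ∃ v : Fin n → ℝ, StrictAnti v ∧ (∀ i, 0 < v i) ∧
      ∫ ω, (M ω).expectedRevenue v ∂P ≤ (1 / 4 + 5 / (n : ℝ)) * v ⟨1, hn⟩ := by
  have hn2 : (2 : ℝ) ≤ n := by exact_mod_cast hn
  have hn0 : (0 : ℝ) < n := by linarith
  obtain ⟨L, hL⟩ := exists_le_wsum_one (n := n) (by omega)
    ((n : ℝ) * (3 * n ^ 2 + 1 + n * ((n ^ 2 + n : ℕ) : ℝ) ^ n))
  have hZ : 0 < wsum L (fun _ : Fin n → ℕ => 1) := lt_of_lt_of_le (by positivity) hL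
  by_contra! hcon
  have key : ∀ s ∈ injSeqs L n, (1 / 4 + 5 / (n : ℝ)) * (n : ℝ) ^ sec s <
      ∫ ω, (M ω).expectedRevenue (fun j => (n : ℝ) ^ s j) ∂P := by
    intro s hs
    obtain ⟨π, hπ⟩ := exists_strictAnti_comp (mem_injSeqs.1 hs).2
    have h1 := hcon (fun j => (n : ℝ) ^ (s ∘ π) j)
      (fun a b hab => pow_lt_pow_right₀ (by linarith) (hπ hab)) fun j => by positivity
    rw [← sec_eq_of_strictAnti hn hπ, sec_comp] at h1
    have h2 : ∀ ω, (M ω).expectedRevenue (fun j => (n : ℝ) ^ (s ∘ π) j) =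
        (M ω).expectedRevenue (fun j => (n : ℝ) ^ s j) := fun ω =>
      expectedRevenue_comp (M ω) (fun j => (n : ℝ) ^ s j) π
    simpa only [h2] using h1
  -- A non-integrable function has integral `0` by convention, which would not exceed the
  -- nonnegative bound in `key`.
  have hint : ∀ s ∈ injSeqs L n,
      Integrable (fun ω => (M ω).expectedRevenue (fun j => (n : ℝ) ^ s j)) P := by
    intro s hs
    by_contra h
    have := key s hs
    rw [integral_undef h] at this
    exact absurd this (not_lt.2 (by positivity))
  have h1 : ∫ ω, wsum L (fun s : Fin n → ℕ =>
      (M ω).expectedRevenue (fun j => (n : ℝ) ^ s j) / (n : ℝ) ^ sec s) ∂P =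
      wsum L (fun s : Fin n → ℕ =>
        (∫ ω, (M ω).expectedRevenue (fun j => (n : ℝ) ^ s j) ∂P) / (n : ℝ) ^ sec s) := by
    unfold wsum
    rw [integral_finsetSum _ fun s hs => ((hint s hs).div_const _).const_mul _]
    refine sum_congr rfl fun s _ => ?_
    rw [integral_const_mul, integral_div]
  have h2 : ∫ ω, wsum L (fun s : Fin n → ℕ =>
      (M ω).expectedRevenue (fun j => (n : ℝ) ^ s j) / (n : ℝ) ^ sec s) ∂P ≤
      (1 / 4 + 5 / (n : ℝ)) * wsum L (fun _ : Fin n → ℕ => 1) := by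
    have hI : Integrable (fun ω => wsum L (fun s : Fin n → ℕ =>
        (M ω).expectedRevenue (fun j => (n : ℝ) ^ s j) / (n : ℝ) ^ sec s)) P :=
      integrable_finsetSum _ fun s hs => ((hint s hs).div_const _).const_mul _
    refine (integral_mono hI (integrable_const
      ((1 / 4 + 5 / (n : ℝ)) * wsum L (fun _ : Fin n → ℕ => 1))) fun ω => ?_).trans_eq (by simp)
    rw [wsum_expectedRevenue]
    exact wsum_ratio_le hn (hon ω) (hv ω) (hir ω) (hp ω) hL
  rw [h1] at h2
  refine absurd h2 (not_le.2 ?_)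
  unfold wsum at hZ ⊢
  rw [mul_sum]
  have hne : (injSeqs L n).Nonempty := by
    by_contra h
    rw [not_nonempty_iff_eq_empty] at h
    rw [h] at hZ
    simp at hZ
  refine sum_lt_sum_of_nonempty hne fun s hs => ?_
  have hw : 0 < wt s := by
    unfold wt
    have h3 := descFactorial_top_pos hs
    positivity
  rw [mul_one, mul_comm]
  refine mul_lt_mul_of_pos_left ?_ hw
  rw [lt_div_iff₀ (by positivity)]
  exact key s hs

end Auction

end

/-! ### The sampling auction -/

namespace Auction

variable {n : ℕ}

theorem maxSeen_nonneg (Θ : TypeProfile n) (i : Fin n) (t : ℝ) : 0 ≤ maxSeen Θ i t := by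
  unfold maxSeen; rw [Finset.le_fold_max]; exact Or.inl le_rfl

theorem le_maxSeen {Θ : TypeProfile n} {i j : Fin n} {t : ℝ} (hji : j ≠ i)
    (hj : (Θ j).arrival ≤ t) : (Θ j).value ≤ maxSeen Θ i t := by
  unfold maxSeen; rw [Finset.le_fold_max]
  exact Or.inr ⟨j, by simp [hji, hj], le_rfl⟩

theorem maxSeen_le {Θ : TypeProfile n} {i : Fin n} {t b : ℝ} (hb : 0 ≤ b)
    (h : ∀ j ≠ i, (Θ j).arrival ≤ t → (Θ j).value ≤ b) : maxSeen Θ i t ≤ b := by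
  unfold maxSeen; rw [Finset.fold_max_le]
  exact ⟨hb, fun j hj => by
    obtain ⟨h1, h2⟩ : j ≠ i ∧ (Θ j).arrival ≤ t := by simpa using hj
    exact h j h1 h2⟩

theorem maxSeen_mono (Θ : TypeProfile n) (i : Fin n) {t t' : ℝ} (h : t ≤ t') :
    maxSeen Θ i t ≤ maxSeen Θ i t' :=
  maxSeen_le (maxSeen_nonneg _ _ _) fun _ hj ha => le_maxSeen hj (ha.trans h)

theorem maxSeen_congr {Θ Θ' : TypeProfile n} {i : Fin n} {t : ℝ}
    (h : ∀ j ≠ i, (Θ j).arrival ≤ t ∨ (Θ' j).arrival ≤ t → Θ j = Θ' j) :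
    maxSeen Θ i t = maxSeen Θ' i t := by
  apply le_antisymm
  · refine maxSeen_le (maxSeen_nonneg _ _ _) fun j hj ha => ?_
    have e := h j hj (Or.inl ha)
    rw [e] at ha ⊢
    exact le_maxSeen hj ha
  · refine maxSeen_le (maxSeen_nonneg _ _ _) fun j hj ha => ?_
    have e := h j hj (Or.inr ha)
    rw [← e] at ha ⊢
    exact le_maxSeen hj ha

/-- The first moment from `T` on at which a bidder of type `θ` has arrived. -/
noncomputable def saleTime (T : ℝ) (θ : BidderType) : ℝ := max θ.arrival T

/-- Bidder `i` is active at her sale time and accepts the largest value seen until `T` among the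
other bidders as her price. -/
def Accepts (T : ℝ) (Θ : TypeProfile n) (i : Fin n) : Prop :=
  saleTime T (Θ i) ≤ (Θ i).departure ∧ maxSeen Θ i T ≤ (Θ i).value

/-- Bidder `i` has an earlier sale time than `j`, or the same one and a smaller index. -/
def Before (T : ℝ) (Θ : TypeProfile n) (i j : Fin n) : Prop :=
  saleTime T (Θ i) < saleTime T (Θ j) ∨ saleTime T (Θ i) = saleTime T (Θ j) ∧ i < j

/-- Bidder `i` is the first one who accepts. -/
def Wins (T : ℝ) (Θ : TypeProfile n) (i : Fin n) : Prop :=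
  Accepts T Θ i ∧ ∀ j, j ≠ i → Accepts T Θ j → Before T Θ i j

theorem Wins.unique {T : ℝ} {Θ : TypeProfile n} {i j : Fin n} (hi : Wins T Θ i)
    (hj : Wins T Θ j) : i = j := by
  by_contra h
  rcases hi.2 j (Ne.symm h) hj.1 with h1 | ⟨h1, h1'⟩ <;>
    rcases hj.2 i h hi.1 with h2 | ⟨h2, h2'⟩
  · exact lt_asymm h1 h2
  · exact h1.ne h2.symm
  · exact h2.ne h1.symm
  · exact lt_asymm h1' h2'

theorem exists_wins {T : ℝ} {Θ : TypeProfile n} (h : ∃ i, Accepts T Θ i) : ∃ i, Wins T Θ i := by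
  classical
  obtain ⟨i, hi⟩ := h
  obtain ⟨j, hj, hmin⟩ := Finset.exists_min_image (Finset.univ.filter fun i => Accepts T Θ i)
    (fun i => toLex (saleTime T (Θ i), i)) ⟨i, by simpa using hi⟩
  refine ⟨j, (Finset.mem_filter.1 hj).2, fun l hl ha => ?_⟩
  have h1 := hmin l (by simpa using ha)
  rw [Prod.Lex.le_iff] at h1
  rcases h1 with h1 | ⟨h1, h2⟩
  · exact Or.inl h1
  · exact Or.inr ⟨h1, lt_of_le_of_ne h2 (Ne.symm hl)⟩

open Classical in
/-- After an observation phase that ends at time `T`, every bidder is offered the item for the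
largest value seen until `T` among the other bidders; the first to accept wins. -/
noncomputable def sampling (n : ℕ) (T : ℝ) : Auction n := fun Θ =>
  if h : ∃ i, Wins T Θ i then
    some (h.choose, saleTime T (Θ h.choose), maxSeen Θ h.choose T)
  else none

theorem sampling_eq_some_of_wins {T : ℝ} {Θ : TypeProfile n} {i : Fin n} (h : Wins T Θ i) :
    sampling n T Θ = some (i, saleTime T (Θ i), maxSeen Θ i T) := by
  have hex : ∃ i, Wins T Θ i := ⟨i, h⟩
  have e : hex.choose = i := hex.choose_spec.unique h
  rw [sampling, dif_pos hex, e]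

theorem wins_of_sampling_eq_some {T : ℝ} {Θ : TypeProfile n} {i : Fin n} {t p : ℝ}
    (h : sampling n T Θ = some (i, t, p)) :
    Wins T Θ i ∧ t = saleTime T (Θ i) ∧ p = maxSeen Θ i T := by
  by_cases hex : ∃ i, Wins T Θ i
  · obtain ⟨j, hj⟩ := hex
    rw [sampling_eq_some_of_wins hj] at h
    simp only [Option.some.injEq, Prod.mk.injEq] at h
    obtain ⟨rfl, rfl, rfl⟩ := h
    exact ⟨hj, rfl, rfl⟩
  · simp [sampling, hex] at h

theorem sampling_isOnline (n : ℕ) (T : ℝ) : (sampling n T).IsOnline := by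
  intro Θ Θ' hΘ hΘ' i t p hM ha
  obtain ⟨hw, rfl, rfl⟩ := wins_of_sampling_eq_some hM
  have hT : T ≤ saleTime T (Θ i) := le_max_right _ _
  have hi : Θ i = Θ' i := ha i (Or.inl (le_max_left _ _))
  have hmax : ∀ j, maxSeen Θ j T = maxSeen Θ' j T := fun j =>
    maxSeen_congr fun l _ hl => ha l (hl.imp (fun h => h.trans hT) fun h => h.trans hT)
  have hw' : Wins T Θ' i := by
    refine ⟨⟨hi ▸ hw.1.1, ?_⟩, fun j hj hacc => ?_⟩
    · rw [← hmax, ← hi]; exact hw.1.2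
    -- A competitor `j` whose sale time under `Θ'` is no later than that of `i` has arrived by then,
    -- so her report is the same in both profiles.
    · by_cases hlt : saleTime T (Θ' i) < saleTime T (Θ' j)
      · exact Or.inl hlt
      · have h1 : (Θ' j).arrival ≤ saleTime T (Θ i) := by
          rw [hi]; exact (le_max_left _ _).trans (not_lt.1 hlt)
        have hj' : Θ j = Θ' j := ha j (Or.inr h1)
        have h2 : Accepts T Θ j := ⟨by rw [hj']; exact hacc.1, by rw [hmax, hj']; exact hacc.2⟩
        have h3 := hw.2 j hj h2
        rw [Before, hi, hj'] at h3
        exact h3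
  rw [sampling_eq_some_of_wins hw', hi, hmax]

theorem sampling_pricesAtMostMaxSeen (n : ℕ) (T : ℝ) : (sampling n T).PricesAtMostMaxSeen := by
  intro Θ _ i t p hM
  obtain ⟨_, rfl, rfl⟩ := wins_of_sampling_eq_some hM
  exact maxSeen_mono Θ i (le_max_right _ _)

theorem utility_of_wins {T : ℝ} {Θ : TypeProfile n} {i : Fin n} (h : Wins T Θ i) :
    (sampling n T Θ).utility i (Θ i) = (Θ i).value - maxSeen Θ i T := by
  rw [sampling_eq_some_of_wins h]
  have h1 : (Θ i).arrival ≤ saleTime T (Θ i) ∧ saleTime T (Θ i) ≤ (Θ i).departure :=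
    ⟨le_max_left _ _, h.1.1⟩
  simp [Outcome.utility, h1]

theorem utility_of_not_wins {T : ℝ} {Θ : TypeProfile n} {i : Fin n} (h : ¬ Wins T Θ i)
    (θ : BidderType) : (sampling n T Θ).utility i θ = 0 := by
  rcases hm : sampling n T Θ with _ | ⟨j, t, p⟩
  · rfl
  · have hj := (wins_of_sampling_eq_some hm).1
    have : j ≠ i := fun e => h (e ▸ hj)
    simp [Outcome.utility, this]

theorem sampling_isIndividuallyRational (n : ℕ) (T : ℝ) :
    (sampling n T).IsIndividuallyRational := by
  intro Θ _ i
  by_cases h : Wins T Θ i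
  · rw [utility_of_wins h]; linarith [h.1.2]
  · rw [utility_of_not_wins h]

/-- The price of a bidder does not depend on her own report. What remains is that a profitable
misreport implies a truthful win. -/
theorem sampling_isStrategyproof (n : ℕ) (T : ℝ) : (sampling n T).IsStrategyproof := by
  intro Θ hΘ i θ' hθ' harr
  have hIR := sampling_isIndividuallyRational n T Θ hΘ i
  set Θ' := Function.update Θ i θ' with hΘ'
  have hi' : Θ' i = θ' := by simp [hΘ']
  have hj' : ∀ j, j ≠ i → Θ' j = Θ j := fun j hj => by simp [hΘ', hj]
  by_cases hw' : Wins T Θ' i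
  swap
  · rw [utility_of_not_wins hw']; exact hIR
  have hp : maxSeen Θ' i T = maxSeen Θ i T := maxSeen_congr fun j hj _ => hj' j hj
  have hp0 := maxSeen_nonneg Θ i T
  have hs : saleTime T (Θ i) ≤ saleTime T θ' := max_le_max harr le_rfl
  have hu' : (sampling n T Θ').utility i (Θ i) =
      (if (Θ i).arrival ≤ saleTime T θ' ∧ saleTime T θ' ≤ (Θ i).departure then (Θ i).value
        else 0) - maxSeen Θ i T := by
    rw [sampling_eq_some_of_wins hw', hi', hp]
    simp [Outcome.utility]
  rw [hu']
  split_ifs with hact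
  swap
  · linarith
  by_cases hval : (Θ i).value ≤ maxSeen Θ i T
  · linarith
  push Not at hval
  have hacc : Accepts T Θ i := ⟨hs.trans hact.2, hval.le⟩
  have hw : Wins T Θ i := by
    refine ⟨hacc, fun j hj hjacc => ?_⟩
    -- If `i` arrives by `T`, an accepting `j` who also arrives by `T` would have a value at least
    -- that of `i`, yet at most the price of `i`, which is smaller. So every accepting rival comes
    -- strictly after `T`.
    by_cases hia : (Θ i).arrival ≤ T
    · have h1 : ¬ (Θ j).arrival ≤ T := fun hja => by
        have h2 : (Θ i).value ≤ maxSeen Θ j T := le_maxSeen hj.symm hia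
        have h3 : (Θ j).value ≤ maxSeen Θ i T := le_maxSeen hj hja
        linarith [hjacc.2]
      push Not at h1
      refine Or.inl ?_
      rw [saleTime, saleTime, max_eq_right hia, max_eq_left h1.le]
      exact h1
    -- If `i` arrives after `T`, neither her true nor her delayed report enters anyone's price, and
    -- the truthful sale time is no later.
    · have hia' : ¬ (Θ' i).arrival ≤ T := fun h => hia (harr.trans (hi' ▸ h))
      have h1 : maxSeen Θ' j T = maxSeen Θ j T := maxSeen_congr fun l _ hl => by
        by_cases hli : l = i
        · subst hli
          exact absurd hl (not_or.2 ⟨hia', hia⟩)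
        · exact hj' l hli
      have h2 : Accepts T Θ' j := by
        refine ⟨?_, ?_⟩
        · rw [hj' j hj]; exact hjacc.1
        · rw [h1, hj' j hj]; exact hjacc.2
      have h3 := hw'.2 j hj h2
      rw [Before, hi', hj' j hj] at h3
      rcases h3 with h3 | ⟨h3, h4⟩
      · exact Or.inl (hs.trans_lt h3)
      · rcases (hs.trans_eq h3).lt_or_eq with h5 | h5
        · exact Or.inl h5
        · exact Or.inr ⟨h5, h4⟩
  rw [utility_of_wins hw]

theorem sampling_revenue_nonneg (T : ℝ) (Θ : TypeProfile n) : 0 ≤ (sampling n T Θ).revenue := by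
  rcases hm : sampling n T Θ with _ | ⟨j, t, p⟩
  · exact le_rfl
  · obtain ⟨_, _, rfl⟩ := wins_of_sampling_eq_some hm
    exact maxSeen_nonneg _ _ _

/-- The largest bidder `a` accepts, so there is a sale. Index `b` is active only at time `b + 1 < k
+ 1`: she is gone before sales start but counts in every winner's price. -/
theorem le_sampling_revenue {w : Fin n → ℝ} {k : ℕ} {a b : Fin n} (hb : (b : ℕ) < k)
    (ha : k ≤ (a : ℕ)) (h0 : 0 ≤ w a) (hmax : ∀ j, w j ≤ w a) :
    w b ≤ (sampling n (k + 1) (disjointProfile w)).revenue := by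
  have hk : (k : ℝ) ≤ a := by exact_mod_cast ha
  have hbk : (b : ℝ) < k := by exact_mod_cast hb
  have hacc : Accepts ((k : ℝ) + 1) (disjointProfile w) a := by
    refine ⟨?_, maxSeen_le h0 fun j _ _ => hmax j⟩
    simp only [saleTime, disjointProfile]
    exact max_le le_rfl (by linarith)
  obtain ⟨i, hi⟩ := exists_wins ⟨a, hacc⟩
  rw [sampling_eq_some_of_wins hi]
  have hbi : b ≠ i := by
    rintro rfl
    have h1 : (k : ℝ) + 1 ≤ (b : ℝ) + 1 := (le_max_right _ _).trans hi.1.1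
    linarith
  exact le_maxSeen (Θ := disjointProfile w) hbi (by simp only [disjointProfile]; linarith)

/-! ### Positions of the two largest values -/

/-- Number of permutations that send `x` to `a` and `y` to `b`. -/
def pairCount (x y a b : Fin n) : ℕ :=
  (Finset.univ.filter fun π : Equiv.Perm (Fin n) => π x = a ∧ π y = b).card

theorem pairCount_eq {x y a b a' b' : Fin n} (hab : a ≠ b) (hab' : a' ≠ b') :
    pairCount x y a b = pairCount x y a' b' := by
  obtain ⟨σ, h1, h2⟩ : ∃ σ : Equiv.Perm (Fin n), σ a = a' ∧ σ b = b' := by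
    refine ⟨(Equiv.swap a a').trans (Equiv.swap (Equiv.swap a a' b) b'), ?_, ?_⟩
    · have h3 : Equiv.swap a a' b ≠ a' := fun h => hab ((Equiv.swap a a').injective (by simp [h]))
      simp [Equiv.swap_apply_of_ne_of_ne h3.symm hab']
    · simp
  unfold pairCount
  refine Finset.card_bij (fun π _ => π.trans σ) ?_ ?_ ?_
  · intro π hπ
    simp only [Finset.mem_filter, Finset.mem_univ, true_and] at hπ ⊢
    simp [hπ.1, hπ.2, h1, h2]
  · intro π _ π' _ h
    ext j
    have := Equiv.congr_fun h j
    simpa using congrArg Fin.val (σ.injective this)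
  · intro π hπ
    simp only [Finset.mem_filter, Finset.mem_univ, true_and] at hπ
    refine ⟨π.trans σ.symm, ?_, by ext; simp⟩
    simp [hπ.1, hπ.2, ← h1, ← h2]

theorem sum_pairCount (x y : Fin n) (S : Finset (Fin n × Fin n)) :
    ∑ p ∈ S, pairCount x y p.1 p.2 =
      (Finset.univ.filter fun π : Equiv.Perm (Fin n) => (π x, π y) ∈ S).card := by
  have h := Finset.card_eq_sum_card_fiberwise
    (s := Finset.univ.filter fun π : Equiv.Perm (Fin n) => (π x, π y) ∈ S)
    (f := fun π : Equiv.Perm (Fin n) => (π x, π y)) (t := S)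
    fun π hπ => (Finset.mem_filter.1 (Finset.mem_coe.1 hπ)).2
  rw [h]
  refine Finset.sum_congr rfl fun p hp => ?_
  rw [pairCount, Finset.filter_filter]
  congr 1
  ext π
  simp only [Finset.mem_filter, Finset.mem_univ, true_and, Prod.ext_iff]
  constructor
  · rintro ⟨h1, h2⟩
    exact ⟨by rw [h1, h2]; exact hp, h1, h2⟩
  · exact fun h => h.2

/-- All ordered pairs of distinct positions have equal counts; taking all such pairs gives the
normalisation `n * (n - 1)`. -/
theorem card_perm_pair {x y : Fin n} (hxy : x ≠ y) {S : Finset (Fin n × Fin n)}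
    (hS : ∀ p ∈ S, p.1 ≠ p.2) :
    (Finset.univ.filter fun π : Equiv.Perm (Fin n) => (π x, π y) ∈ S).card * (n * (n - 1)) =
      S.card * n.factorial := by
  have h1 : ∀ S : Finset (Fin n × Fin n), (∀ p ∈ S, p.1 ≠ p.2) →
      (Finset.univ.filter fun π : Equiv.Perm (Fin n) => (π x, π y) ∈ S).card =
        S.card * pairCount x y x y := by
    intro S hS
    rw [← sum_pairCount, Finset.sum_congr rfl fun p hp => pairCount_eq (hS p hp) hxy,
      Finset.sum_const, smul_eq_mul]
  have h2 := h1 Finset.univ.offDiag fun p hp => (Finset.mem_offDiag.1 hp).2.2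
  have h3 : (Finset.univ.filter fun π : Equiv.Perm (Fin n) =>
      (π x, π y) ∈ (Finset.univ : Finset (Fin n)).offDiag).card = n.factorial := by
    rw [Finset.filter_true_of_mem, Finset.card_univ, Fintype.card_perm, Fintype.card_fin]
    intro π _
    simpa using hxy
  rw [h3, Finset.offDiag_card, Finset.card_univ, Fintype.card_fin] at h2
  rw [h1 S hS, h2, ← Nat.mul_sub_one]
  ring

theorem le_sampling_expectedRevenue {k : ℕ} (hn : 2 ≤ n) (hk : k = n / 2) {v : Fin n → ℝ}
    (hv : Antitone v) (h0 : ∀ i, 0 ≤ v i) :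
    1 / 4 * v ⟨1, hn⟩ ≤ (sampling n (k + 1)).expectedRevenue v := by
  classical
  set x : Fin n := ⟨1, hn⟩ with hx
  set y : Fin n := ⟨0, by omega⟩ with hy
  have hxy : x ≠ y := by simp [hx, hy]
  set S : Finset (Fin n × Fin n) :=
    (Finset.univ.filter fun b : Fin n => (b : ℕ) < k) ×ˢ
      (Finset.univ.filter fun a : Fin n => k ≤ (a : ℕ)) with hS
  have hcard : S.card = k * (n - k) := by
    have h1 : (Finset.univ.filter fun b : Fin n => (b : ℕ) < k).card = k := by
      rw [Fin.card_filter_val_lt]; omega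
    have h2 : (Finset.univ.filter fun b : Fin n => k ≤ (b : ℕ)).card = n - k := by
      have := Finset.card_filter_add_card_filter_not (s := (Finset.univ : Finset (Fin n)))
        (fun b : Fin n => (b : ℕ) < k)
      simp only [not_lt] at this
      rw [h1, Finset.card_univ, Fintype.card_fin] at this
      omega
    rw [hS, Finset.card_product, h1, h2]
  have hcount := card_perm_pair hxy (S := S) fun p hp => by
    obtain ⟨h1, h2⟩ := Finset.mem_product.1 hp
    have h1 := (Finset.mem_filter.1 h1).2
    have h2 := (Finset.mem_filter.1 h2).2
    exact Fin.ne_of_val_ne (by omega)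
  set N := (Finset.univ.filter fun π : Equiv.Perm (Fin n) => (π x, π y) ∈ S).card with hN
  -- The probability of the good event is `k * (n - k) / (n * (n - 1))`.
  have hquarter : n * (n - 1) ≤ 4 * (k * (n - k)) := by
    rcases Nat.even_or_odd' n with ⟨m, rfl | rfl⟩
    · have : k = m := by omega
      subst this
      rw [show 2 * k - k = k by omega]
      calc 2 * k * (2 * k - 1) ≤ 2 * k * (2 * k) := Nat.mul_le_mul_left _ (Nat.sub_le _ _)
        _ = _ := by ring
    · have : k = m := by omega
      subst this
      rw [show 2 * k + 1 - k = k + 1 by omega, Nat.add_sub_cancel]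
      nlinarith
  have hNfact : n.factorial ≤ 4 * N := by
    have h1 : 0 < n * (n - 1) := Nat.mul_pos (by omega) (by omega)
    refine Nat.le_of_mul_le_mul_right ?_ h1
    rw [mul_assoc, hcount, hcard, mul_comm]
    calc n * (n - 1) * n.factorial ≤ 4 * (k * (n - k)) * n.factorial :=
          Nat.mul_le_mul_right _ hquarter
      _ = _ := by ring
  have hrev : (N : ℝ) * v x ≤
      ∑ π : Equiv.Perm (Fin n), (sampling n (k + 1) (disjointProfile (v ∘ π))).revenue := by
    -- Under `v ∘ π` the value of rank `x` stands at position `π.symm x`; passing to inverses makes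
    -- `π x` its position.
    have e : ∑ π : Equiv.Perm (Fin n), (sampling n (k + 1) (disjointProfile (v ∘ π))).revenue =
        ∑ π : Equiv.Perm (Fin n), (sampling n (k + 1) (disjointProfile (v ∘ π.symm))).revenue :=
      (Fintype.sum_equiv (Equiv.inv (Equiv.Perm (Fin n))) _ _ fun π => rfl).symm
    rw [e, ← nsmul_eq_mul, hN, ← Finset.sum_const, Finset.sum_filter]
    refine Finset.sum_le_sum fun π _ => ?_
    split_ifs with hπ
    · obtain ⟨h1, h2⟩ := Finset.mem_product.1 hπ
      have h1 := (Finset.mem_filter.1 h1).2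
      have h2 := (Finset.mem_filter.1 h2).2
      have h3 := le_sampling_revenue (w := v ∘ π.symm) h1 h2 (by simpa using h0 y) fun j => by
        simp only [Function.comp_apply, Equiv.symm_apply_apply]
        exact hv (by simp [hy, Fin.le_def])
      simpa using h3
    · exact sampling_revenue_nonneg _ _
  unfold expectedRevenue
  have hf : (0 : ℝ) < n.factorial := by exact_mod_cast n.factorial_pos
  rw [le_div_iff₀ hf]
  have h4 : (n.factorial : ℝ) ≤ 4 * N := by exact_mod_cast hNfact
  have h5 := mul_le_mul_of_nonneg_right h4 (h0 x)
  linarith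

end Auction

theorem mainTheorem3 :
    (∃ C : ℝ, ∀ n : ℕ, ∀ hn : 2 ≤ n,
      ∀ (Ω : Type*) [MeasurableSpace Ω] (P : Measure Ω) [IsProbabilityMeasure P]
        (M : Ω → Auction n), MeasurableAuction M →
        (∀ ω, (M ω).IsOnline) →
        (∀ ω, (M ω).IsValueStrategyproof) →
        (∀ ω, (M ω).IsIndividuallyRational) →
        (∀ ω, (M ω).PricesAtMostMaxSeen) →
        ∃ v : Fin n → ℝ, StrictAnti v ∧ (∀ i, 0 < v i) ∧
          ∫ ω, (M ω).expectedRevenue v ∂P ≤ (1 / 4 + C / (n : ℝ)) * v ⟨1, hn⟩) ∧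
    (∀ n : ℕ, ∀ hn : 2 ≤ n,
      ∃ M : Auction n, M.IsOnline ∧ M.IsStrategyproof ∧ M.IsIndividuallyRational ∧
        M.PricesAtMostMaxSeen ∧
        ∀ v : Fin n → ℝ, Antitone v → (∀ i, 0 ≤ v i) →
          1 / 4 * v ⟨1, hn⟩ ≤ M.expectedRevenue v) := by
  refine ⟨⟨5, ?_⟩, ?_⟩
  · intro n hn Ω _ P _ M _ hon hv hir hp
    exact Auction.exists_values_expectedRevenue_le hn P M hon hv hir hp
  · intro n hn
    exact ⟨Auction.sampling n ((n / 2 : ℕ) + 1), Auction.sampling_isOnline n _,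
      Auction.sampling_isStrategyproof n _, Auction.sampling_isIndividuallyRational n _,
      Auction.sampling_pricesAtMostMaxSeen n _, fun v hv h0 =>
        Auction.le_sampling_expectedRevenue hn rfl hv h0⟩
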